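/- Let $\Omega$ be the set of pairs $\omega=(I,S)$ of continuous functions $I,S:[0,\infty)\to(0,\infty)$ with $I(0)=1$, with the $\sigma$-algebra generated by the evaluations $\omega\mapsto\omega(t):=(I(t),S(t))$. A stopping time is a measurable $\tau:\Omega\to[0,\infty]$ such that $\omega|_{[0,\tau(\omega)]}=\omega'|_{[0,\tau(\omega)]}$ implies $\tau(\omega)=\tau(\omega')$; a measurable $X:\Omega\to\mathbb{R}^2$ is $\tau$-measurable if $\omega|_{[0,\tau(\omega)]}=\omega'|_{[0,\tau(\omega)]}$ implies $X(\omega)=X(\omega')$. A simple capital process is a function \[ c+\sum_{n\ge1} h_n(\omega)\cdot\bigl(\omega(\tau_{n+1}\wedge t)-\omega(\tau_n\wedge t)\bigr), \qquad t\in[0,\infty),\ \omega\in\Omega, \] where $c\in\mathbb{R}$, $\tau_1\le\tau_2\le\cdots$ are stopping times with $\tau_n(\omega)\to\infty$ for every $\omega$, and each $h_n:\Omega\to\mathbb{R}^2$ is bounded and $\tau_n$-measurable. Test supermartingales are the members of the smallest class of processes $[0,\infty)\times\Omega\to[-\infty,\infty]$ that contains all nonnegative simple capital processes and is closed under $(X^k)_k\mapsto\liminf_{k\to\infty}X^k$.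 A test $I$-supermartingale is a process of the form $X_t(\omega)/I(t)$ with $X$ a test supermartingale. A property $E\subseteq[0,\infty)\times\Omega$ holds quasi-always if there is a test supermartingale $X$ with $X_0=1$ such that $X_t(\omega)=\infty$ whenever $(s,\omega)\notin E$ for some $s<t$. Let $T^n_0:=0$ and $T^n_k:=\inf\{t>T^n_{k-1} : |I(t)-I(T^n_{k-1})|=2^{-n}\}$ (with $\inf\emptyset=\infty$) for $k\ge1$, let \[ m^n_k(t):=\frac{I(T^n_k\wedge t)-I(T^n_{k-1}\wedge t)}{I(T^n_{k-1}\wedge t)}, \] and let $\mathrm{M}^I_t:=\lim_{n\to\infty}\sum_{k\ge1} m^n_k(t)$ and $\Sigma^I_t:=\lim_{n\to\infty}\sum_{k\ge1} m^n_k(t)^2$, where these limits exist in $\mathbb{R}$. \textbf{Lemma.} For every $\epsilon\in\mathbb{R}$ there is a test $I$-supermartingale $Y$ such that, quasi-always, both limits $\mathrm{M}^I_t$ and $\Sigma^I_t$ exist and \[ Y_t=\exp\Bigl(\epsilon(\mathrm{M}^I_t-\Sigma^I_t)-\frac{\epsilon^2}{2}\Sigma^I_t\Bigr). \] -/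

import Mathlib

open Filter Topology
open scoped NNReal ENNReal

namespace EfficientIndex

/-- The sample space: pairs `ω = (I, S)` of positive continuous price paths on `[0, ∞)`,
the index being normalised by `I(0) = 1`. -/
structure Path where
  I : ℝ≥0 → ℝ
  S : ℝ≥0 → ℝ
  continuous_I : Continuous I
  continuous_S : Continuous S
  I_pos : ∀ t, 0 < I t
  S_pos : ∀ t, 0 < S t
  I_zero : I 0 = 1

/-- The value `ω(t) = (I(t), S(t))`. -/
def Path.val (ω : Path) (t : ℝ≥0) : ℝ × ℝ := (ω.I t, ω.S t)

/-- The σ-algebra generated by the evaluations `ω ↦ ω(t)`. -/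
instance : MeasurableSpace Path :=
  ⨆ t : ℝ≥0, MeasurableSpace.comap (fun ω : Path => ω.val t) inferInstance

/-- `ω` and `ω'` have the same restriction to `[0, r] ∩ [0, ∞)`. -/
def AgreeUpTo (r : ℝ≥0∞) (ω ω' : Path) : Prop :=
  ∀ s : ℝ≥0, (s : ℝ≥0∞) ≤ r → ω.val s = ω'.val s

/-- Stopping times with values in `[0, ∞]`. -/
structure IsStopTime (τ : Path → ℝ≥0∞) : Prop where
  measurable : Measurable τ
  eq_of_agree : ∀ ω ω', AgreeUpTo (τ ω) ω ω' → τ ω = τ ω'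

/-- `X` is a random vector (in `ℝ²`) that is `τ`-measurable. -/
structure IsMeasurableAt (τ : Path → ℝ≥0∞) (X : Path → ℝ × ℝ) : Prop where
  measurable : Measurable X
  eq_of_agree : ∀ ω ω', AgreeUpTo (τ ω) ω ω' → X ω = X ω'

/-- The finite time `r ∧ t`, for `r ∈ [0, ∞]` and `t ∈ [0, ∞)`. -/
noncomputable def cap (r : ℝ≥0∞) (t : ℝ≥0) : ℝ≥0 := (min r (t : ℝ≥0∞)).toNNReal

/-- A simple trading strategy: nondecreasing stopping times `τ 0 ≤ τ 1 ≤ ⋯` tending to `∞`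
on every path, and bounded `τ n`-measurable positions `h n` in `(I, S)` that are held between
`τ n` and `τ (n + 1)`. -/
structure SimpleStrategy where
  τ : ℕ → Path → ℝ≥0∞
  h : ℕ → Path → ℝ × ℝ
  isStopTime : ∀ n, IsStopTime (τ n)
  mono : ∀ n ω, τ n ω ≤ τ (n + 1) ω
  tendsto : ∀ ω, Tendsto (fun n => τ n ω) atTop (𝓝 ⊤)
  bounded : ∀ n, ∃ C : ℝ, ∀ ω, ‖h n ω‖ ≤ C
  adapted : ∀ n, IsMeasurableAt (τ n) (h n)

/-- The gain, up to time `t`, from the `n`th position (a dot product in `ℝ²`). -/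
noncomputable def SimpleStrategy.gain (G : SimpleStrategy) (n : ℕ) (t : ℝ≥0) (ω : Path) : ℝ :=
  (G.h n ω).1 * (ω.I (cap (G.τ (n + 1) ω) t) - ω.I (cap (G.τ n ω) t)) +
    (G.h n ω).2 * (ω.S (cap (G.τ (n + 1) ω) t) - ω.S (cap (G.τ n ω) t))

/-- The sum defining a simple capital process has only finitely many nonzero terms. -/
theorem SimpleStrategy.finite_support_gain (G : SimpleStrategy) (t : ℝ≥0) (ω : Path) :
    (Function.support fun n => G.gain n t ω).Finite := by
  have h1 : ∀ᶠ n in atTop, (t : ℝ≥0∞) < G.τ n ω :=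
    (G.tendsto ω).eventually (lt_mem_nhds ENNReal.coe_lt_top)
  obtain ⟨N, hN⟩ := eventually_atTop.1 h1
  refine (Set.finite_lt_nat N).subset fun n hn => ?_
  by_contra hlt
  have hle : N ≤ n := not_lt.1 hlt
  apply hn
  have e1 : cap (G.τ n ω) t = t := by simp [cap, min_eq_right (hN n hle).le]
  have e2 : cap (G.τ (n + 1) ω) t = t := by
    simp [cap, min_eq_right (hN (n + 1) (by omega)).le]
  simp [SimpleStrategy.gain, e1, e2]

/-- The simple capital process with initial capital `c`. -/
noncomputable def SimpleStrategy.capital (G : SimpleStrategy) (c : ℝ) (t : ℝ≥0) (ω : Path) : ℝ :=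
  c + ∑' n, G.gain n t ω

/-- Processes `[0, ∞) × Ω → [-∞, ∞]`. -/
abbrev PriceProcess := ℝ≥0 → Path → EReal

/-- Test supermartingales: the smallest class of processes that contains all nonnegative simple
capital processes and is closed under `liminf` of sequences. -/
inductive IsTestSupermartingale : PriceProcess → Prop
  | simple (G : SimpleStrategy) (c : ℝ) (hnonneg : ∀ t ω, 0 ≤ G.capital c t ω) :
      IsTestSupermartingale fun t ω => (G.capital c t ω : EReal)
  | liminf (X : ℕ → PriceProcess) (hX : ∀ k, IsTestSupermartingale (X k)) :
      IsTestSupermartingale fun t ω => Filter.liminf (fun k => X k t ω) atTop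

/-- Test `I`-supermartingales: the processes `X_t / I_t`, `X` a test supermartingale. -/
def IsTestISupermartingale (Y : PriceProcess) : Prop :=
  ∃ X : PriceProcess, IsTestSupermartingale X ∧ Y = fun t ω => X t ω / (ω.I t : EReal)

/-- A time-dependent property `E` holds quasi-always: some test supermartingale starting from `1`
is infinite at every time after a violation of `E`. -/
def QuasiAlways (E : Set (ℝ≥0 × Path)) : Prop :=
  ∃ X : PriceProcess, IsTestSupermartingale X ∧ (∀ ω, X 0 ω = 1) ∧
    ∀ t ω, (∃ s < t, (s, ω) ∉ E) → X t ω = ⊤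

/-- The stopping times `T^n_k`: `T^n_0 = 0`, and `T^n_{k+1}` is the first time after `T^n_k` at
which `I` has moved by `2^{-n}` from its value at `T^n_k` (`∞` if there is no such time). -/
noncomputable def gridTime (n : ℕ) (ω : Path) : ℕ → ℝ≥0∞
  | 0 => 0
  | k + 1 => sInf {r : ℝ≥0∞ | ∃ t : ℝ≥0, r = t ∧ gridTime n ω k < t ∧
      |ω.I t - ω.I (gridTime n ω k).toNNReal| = (2 : ℝ)⁻¹ ^ n}

/-- The relative increment of `I` between `T^n_k ∧ t` and `T^n_{k+1} ∧ t`. -/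
noncomputable def relIncrement (n : ℕ) (t : ℝ≥0) (ω : Path) (k : ℕ) : ℝ :=
  (ω.I (cap (gridTime n ω (k + 1)) t) - ω.I (cap (gridTime n ω k) t)) /
    ω.I (cap (gridTime n ω k) t)

/-- `M^{I,n}_t`. -/
noncomputable def growthApprox (n : ℕ) (t : ℝ≥0) (ω : Path) : ℝ :=
  ∑' k, relIncrement n t ω k

/-- `Σ^{I,n}_t`. -/
noncomputable def variationApprox (n : ℕ) (t : ℝ≥0) (ω : Path) : ℝ :=
  ∑' k, relIncrement n t ω k ^ 2

/-- The cumulative relative growth `M^I_t = lim_n M^{I,n}_t` (meaningful where the limit exists). -/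
noncomputable def growth (t : ℝ≥0) (ω : Path) : ℝ :=
  limUnder atTop fun n => growthApprox n t ω

/-- The relative quadratic variation `Σ^I_t = lim_n Σ^{I,n}_t` (meaningful where the limit
exists). -/
noncomputable def variation (t : ℝ≥0) (ω : Path) : ℝ :=
  limUnder atTop fun n => variationApprox n t ω

end EfficientIndex

/-!
Let `a = 1 + ε`. On the grid of level `n`, the strategy with constant leverage `a` in the index has
the capital `∏ (1 + a m_k)`, where the `m_k` are the relative increments of `I`. Its logarithm is
`a M - a² Σ / 2` up to an error of order `max |m_k| · Σ`, and for `a = 1` the product telescopes to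
`I` itself. So, wherever the approximations to the growth `M` converge to a finite limit,
`log I = M - Σ / 2` forces the approximations to the variation `Σ` to converge too
(`tendsto_variationApprox`), and the capital tends to `exp (a M - a² Σ / 2)`
(`tendsto_wealth_leveraged`). The lower limit of these capitals is a test supermartingale, and
dividing it by `I = exp (M - Σ / 2)` gives the required process.

It remains to see that the approximations `Mⁿ` converge quasi-always. On the common refinement of
the grids of levels `n` and `n + 1`, with times `r_k`, the strategy with the relative positions
`1 / (8 I(r_k)) ± (3/2)ⁿ (1 / Iⁿ - 1 / Iⁿ⁺¹)`, where `Iⁿ` is the last grid value of `I`, has a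
capital whose logarithm is at least `log I / 8 ± (3/2)ⁿ (Mⁿ - Mⁿ⁺¹)` for large `n`: as
`(3/2)ⁿ 2⁻ⁿ → 0`, the quadratic cost of the bet is covered by the quadratic gain from holding a
fixed fraction of the capital in the index (`le_log_wealth_betweenGrids`). Each strategy is stopped
once its capital is of order `2ⁿ`, and all are mixed with weights of order `2⁻ⁿ`. Where the
mixture is finite, `|Mⁿ - Mⁿ⁺¹|` is eventually at most `(2/3)ⁿ` times a linear function of `n`,
which is summable (`exists_isTestSupermartingale_growth`). The mixture is a test supermartingale
because strategies on two sequences of stopping times can be carried out on their common refinement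
(`IsGain.add`).
-/

namespace EfficientIndex

/-! ### Stopping times and values at random times -/

theorem measurable_val (t : ℝ≥0) : Measurable fun ω : Path => ω.val t :=
  Measurable.of_comap_le (le_iSup (fun t : ℝ≥0 =>
    MeasurableSpace.comap (fun ω : Path => ω.val t) inferInstance) t)

theorem measurable_I_uncurry : Measurable fun p : ℝ≥0 × Path => p.2.I p.1 :=
  MeasureTheory.measurable_uncurry_of_continuous_of_measurable
    (u := fun (t : ℝ≥0) (ω : Path) => ω.I t)
    (fun ω => ω.continuous_I) fun t => (measurable_val t).fst

theorem measurable_I_comp {σ : Path → ℝ≥0} (hσ : Measurable σ) :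
    Measurable fun ω : Path => ω.I (σ ω) :=
  measurable_I_uncurry.comp (hσ.prodMk measurable_id)

theorem measurable_cap {σ : Path → ℝ≥0∞} {u : Path → ℝ≥0} (hσ : Measurable σ)
    (hu : Measurable u) : Measurable fun ω => cap (σ ω) (u ω) :=
  (hσ.min hu.coe_nnreal_ennreal).ennreal_toNNReal

theorem AgreeUpTo.symm {r : ℝ≥0∞} {ω ω' : Path} (h : AgreeUpTo r ω ω') : AgreeUpTo r ω' ω :=
  fun s hs => (h s hs).symm

theorem AgreeUpTo.mono {r r' : ℝ≥0∞} {ω ω' : Path} (h : AgreeUpTo r ω ω') (hr : r' ≤ r) :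
    AgreeUpTo r' ω ω' :=
  fun s hs => h s (hs.trans hr)

theorem AgreeUpTo.I_eq {r : ℝ≥0∞} {ω ω' : Path} (h : AgreeUpTo r ω ω') {s : ℝ≥0}
    (hs : (s : ℝ≥0∞) ≤ r) : ω.I s = ω'.I s :=
  congrArg Prod.fst (h s hs)

theorem coe_toNNReal_le (r : ℝ≥0∞) : (r.toNNReal : ℝ≥0∞) ≤ r := ENNReal.coe_toNNReal_le_self

theorem cap_le_right (r : ℝ≥0∞) (t : ℝ≥0) : cap r t ≤ t := by
  have : ((cap r t : ℝ≥0) : ℝ≥0∞) ≤ t := (coe_toNNReal_le _).trans (min_le_right _ _)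
  exact_mod_cast this

theorem coe_cap (r : ℝ≥0∞) (t : ℝ≥0) : ((cap r t : ℝ≥0) : ℝ≥0∞) = min r t :=
  ENNReal.coe_toNNReal (ne_top_of_le_ne_top ENNReal.coe_ne_top (min_le_right _ _))

theorem cap_of_le {r : ℝ≥0∞} {t : ℝ≥0} (h : (t : ℝ≥0∞) ≤ r) : cap r t = t := by
  simp [cap, min_eq_right h]

theorem cap_of_ge {r : ℝ≥0∞} {t : ℝ≥0} (h : r ≤ t) : cap r t = r.toNNReal := by
  simp [cap, min_eq_left h]

theorem zero_cap (t : ℝ≥0) : cap 0 t = 0 := by simp [cap]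

theorem toNNReal_le_of_le_coe {r : ℝ≥0∞} {t : ℝ≥0} (h : r ≤ t) : r.toNNReal ≤ t :=
  ENNReal.coe_le_coe.1 ((coe_toNNReal_le r).trans h)

/-- A sequence of stopping times increasing from `0` to `∞`. -/
structure Partition where
  τ : ℕ → Path → ℝ≥0∞
  zero : ∀ ω, τ 0 ω = 0
  isStopTime : ∀ n, IsStopTime (τ n)
  mono : ∀ n ω, τ n ω ≤ τ (n + 1) ω
  tendsto : ∀ ω, Tendsto (fun n => τ n ω) atTop (𝓝 ⊤)

namespace Partition

/-- The increment of `I` over the part before time `t` of the `k`th interval of the partition. -/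
noncomputable def incr (P : Partition) (k : ℕ) (t : ℝ≥0) (ω : Path) : ℝ :=
  ω.I (cap (P.τ (k + 1) ω) t) - ω.I (cap (P.τ k ω) t)

/-- The sequence `h` of scalar positions is such that `h k` is known at the `k`th time. -/
structure Adapted (P : Partition) (h : ℕ → Path → ℝ) : Prop where
  measurable : ∀ k, Measurable (h k)
  eq_of_agree : ∀ k ω ω', AgreeUpTo (P.τ k ω) ω ω' → h k ω = h k ω'

variable (P : Partition)

theorem monotone (ω : Path) : Monotone fun k => P.τ k ω :=
  monotone_nat_of_le_succ fun n => P.mono n ω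

theorem exists_lt (t : ℝ≥0) (ω : Path) : ∃ n, (t : ℝ≥0∞) < P.τ n ω :=
  ((P.tendsto ω).eventually (lt_mem_nhds ENNReal.coe_lt_top)).exists

open Classical in
/-- The number of times of the partition that are at most `t`. -/
noncomputable def count (t : ℝ≥0) (ω : Path) : ℕ := Nat.find (P.exists_lt t ω)

theorem lt_of_count_le {t : ℝ≥0} {ω : Path} {k : ℕ} (hk : P.count t ω ≤ k) :
    (t : ℝ≥0∞) < P.τ k ω := by
  classical
  exact (Nat.find_spec (P.exists_lt t ω)).trans_le (P.monotone ω hk)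

theorem incr_eq_zero {k : ℕ} {t : ℝ≥0} {ω : Path} (h : (t : ℝ≥0∞) ≤ P.τ k ω) :
    P.incr k t ω = 0 := by
  rw [incr, cap_of_le h, cap_of_le (h.trans (P.mono k ω)), sub_self]

theorem incr_zero_time (k : ℕ) (ω : Path) : P.incr k 0 ω = 0 := P.incr_eq_zero (by simp)

/-- Up to the `m`th time, stopping at that time or at any later one makes no difference. -/
theorem incr_toNNReal {k m : ℕ} (hkm : k < m) {t : ℝ≥0} {ω : Path} (h : P.τ m ω ≤ t) :
    P.incr k (P.τ m ω).toNNReal ω = P.incr k t ω := by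
  have htop : P.τ m ω ≠ ⊤ := ne_top_of_le_ne_top ENNReal.coe_ne_top h
  have key : ∀ j ≤ m, cap (P.τ j ω) (P.τ m ω).toNNReal = cap (P.τ j ω) t := by
    intro j hj
    have hj' : P.τ j ω ≤ P.τ m ω := P.monotone ω hj
    rw [cap_of_ge (hj'.trans h), cap_of_ge]
    rwa [ENNReal.coe_toNNReal htop]
  rw [incr, incr, key k hkm.le, key (k + 1) hkm]

/-- The value at time `t` of the integral with respect to `I` of the step function that
equals `h k` on the `k`th interval of the partition. -/
noncomputable def integral (h : ℕ → Path → ℝ) (t : ℝ≥0) (ω : Path) : ℝ :=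
  ∑ k ∈ Finset.range (P.count t ω), h k ω * P.incr k t ω

theorem integral_eq_sum (h : ℕ → Path → ℝ) {t : ℝ≥0} {ω : Path} {N : ℕ}
    (hN : P.count t ω ≤ N) :
    P.integral h t ω = ∑ k ∈ Finset.range N, h k ω * P.incr k t ω := by
  refine Finset.sum_subset (Finset.range_mono hN) fun k _ hk => ?_
  rw [P.incr_eq_zero (P.lt_of_count_le (by simpa using hk)).le, mul_zero]

theorem adapted_inv_I : P.Adapted fun k ω => (ω.I (P.τ k ω).toNNReal)⁻¹ where
  measurable k := (measurable_I_comp (P.isStopTime k).measurable.ennreal_toNNReal).inv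
  eq_of_agree k ω ω' h := by
    rw [← (P.isStopTime k).eq_of_agree ω ω' h, h.I_eq (coe_toNNReal_le _)]

variable {P}

theorem Adapted.add {h h' : ℕ → Path → ℝ} (hh : P.Adapted h) (hh' : P.Adapted h') :
    P.Adapted fun k ω => h k ω + h' k ω where
  measurable k := (hh.measurable k).add (hh'.measurable k)
  eq_of_agree k ω ω' ha := by rw [hh.eq_of_agree k ω ω' ha, hh'.eq_of_agree k ω ω' ha]

theorem Adapted.const_mul {h : ℕ → Path → ℝ} (hh : P.Adapted h) (r : ℝ) :
    P.Adapted fun k ω => r * h k ω where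
  measurable k := (hh.measurable k).const_mul r
  eq_of_agree k ω ω' ha := by rw [hh.eq_of_agree k ω ω' ha]

open Classical in
/-- The positions `b`, closed wherever they exceed `B` in absolute value. -/
noncomputable def clip (B : ℝ) (b : ℕ → Path → ℝ) (k : ℕ) (ω : Path) : ℝ :=
  if |b k ω| ≤ B then b k ω else 0

theorem abs_clip_le {B : ℝ} (hB : 0 ≤ B) (b : ℕ → Path → ℝ) (k : ℕ) (ω : Path) :
    |clip B b k ω| ≤ B := by
  unfold clip
  split_ifs with h
  · exact h
  · simpa using hB

theorem Adapted.clip {b : ℕ → Path → ℝ} (hb : P.Adapted b) (B : ℝ) : P.Adapted (clip B b) where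
  measurable k := by
    classical
    exact Measurable.ite (measurableSet_le (hb.measurable k).abs measurable_const)
      (hb.measurable k) measurable_const
  eq_of_agree k ω ω' h := by simp only [Partition.clip, hb.eq_of_agree k ω ω' h]

end Partition

/-! ### The grids of hitting times -/

theorem gridTime_le_succ (n : ℕ) (ω : Path) (k : ℕ) : gridTime n ω k ≤ gridTime n ω (k + 1) := by
  rw [gridTime]
  refine le_sInf ?_
  rintro r ⟨t, rfl, h, -⟩
  exact h.le

/-- A finite hitting time is attained. -/
theorem gridTime_succ_spec {n : ℕ} {ω : Path} {k : ℕ} (h : gridTime n ω (k + 1) ≠ ⊤) :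
    gridTime n ω k < gridTime n ω (k + 1) ∧
      |ω.I (gridTime n ω (k + 1)).toNNReal - ω.I (gridTime n ω k).toNNReal| = (2 : ℝ)⁻¹ ^ n := by
  set g := gridTime n ω k with hg
  set s : ℝ≥0 := (gridTime n ω (k + 1)).toNNReal with hs
  set A : Set ℝ≥0 := {t : ℝ≥0 | g ≤ t ∧ |ω.I t - ω.I g.toNNReal| = (2 : ℝ)⁻¹ ^ n} with hA
  have hpos : (0 : ℝ) < (2 : ℝ)⁻¹ ^ n := by positivity
  have hlt : ∀ t ∈ A, g < t := by
    rintro t ⟨h1, h2⟩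
    refine lt_of_le_of_ne h1 fun h3 => ?_
    rw [h3] at h2
    simp only [ENNReal.toNNReal_coe, sub_self, abs_zero] at h2
    exact hpos.ne h2
  have hclosed : IsClosed A := by
    refine (isClosed_le continuous_const ENNReal.continuous_coe).inter ?_
    exact isClosed_eq ((ω.continuous_I.sub continuous_const).abs) continuous_const
  have hset : {r : ℝ≥0∞ | ∃ t : ℝ≥0, r = t ∧ g < t ∧ |ω.I t - ω.I g.toNNReal| = (2 : ℝ)⁻¹ ^ n}
      = (fun t : ℝ≥0 => (t : ℝ≥0∞)) '' A := by
    ext r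
    constructor
    · rintro ⟨t, rfl, h1, h2⟩
      exact ⟨t, ⟨h1.le, h2⟩, rfl⟩
    · rintro ⟨t, ht, rfl⟩
      exact ⟨t, rfl, hlt t ht, ht.2⟩
  have hval : gridTime n ω (k + 1) = sInf ((fun t : ℝ≥0 => (t : ℝ≥0∞)) '' A) := by
    rw [gridTime, ← hset]
  have hne : A.Nonempty := by
    by_contra hemp
    rw [Set.not_nonempty_iff_eq_empty] at hemp
    rw [hemp] at hval
    simp at hval
    exact h hval
  have hmem : sInf A ∈ A := hclosed.csInf_mem hne (OrderBot.bddBelow A)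
  have hsA : ((sInf A : ℝ≥0) : ℝ≥0∞) = gridTime n ω (k + 1) := by
    rw [hval, sInf_image, ENNReal.coe_sInf hne]
  have hs' : s = sInf A := by rw [hs, ← hsA, ENNReal.toNNReal_coe]
  rw [hs', ← hsA]
  exact ⟨hlt _ hmem, hmem.2⟩

theorem gridTime_succ_le {n : ℕ} {ω : Path} {k : ℕ} {t : ℝ≥0} (h : gridTime n ω k < t)
    (h' : |ω.I t - ω.I (gridTime n ω k).toNNReal| = (2 : ℝ)⁻¹ ^ n) :
    gridTime n ω (k + 1) ≤ t := by
  rw [gridTime]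
  exact sInf_le ⟨t, rfl, h, h'⟩

/-- By the intermediate value theorem, the grid time comes no later than the first time at which
`I` is at least `2⁻ⁿ` away from its previous grid value. -/
theorem gridTime_succ_le_of_le_abs {n : ℕ} {ω : Path} {k : ℕ} {t : ℝ≥0}
    (h : gridTime n ω k ≤ t)
    (h' : (2 : ℝ)⁻¹ ^ n ≤ |ω.I t - ω.I (gridTime n ω k).toNNReal|) :
    gridTime n ω (k + 1) ≤ t := by
  set g := gridTime n ω k with hg
  have hpos : (0 : ℝ) < (2 : ℝ)⁻¹ ^ n := by positivity
  have hgt : g ≠ ⊤ := ne_top_of_le_ne_top ENNReal.coe_ne_top h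
  have hle : g.toNNReal ≤ t := toNNReal_le_of_le_coe h
  have hc : ContinuousOn (fun s : ℝ≥0 => |ω.I s - ω.I g.toNNReal|) (Set.Icc g.toNNReal t) :=
    ((ω.continuous_I.sub continuous_const).abs).continuousOn
  obtain ⟨u, hu, hu'⟩ := intermediate_value_Icc hle hc
    (show (2 : ℝ)⁻¹ ^ n ∈ Set.Icc _ _ from ⟨by simp, h'⟩)
  have hlt : g < u := by
    rw [← ENNReal.coe_toNNReal hgt]
    refine ENNReal.coe_lt_coe.2 (lt_of_le_of_ne hu.1 fun he => ?_)
    rw [← he] at hu'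
    simp only [sub_self, abs_zero] at hu'
    exact hpos.ne hu'
  exact (gridTime_succ_le hlt hu').trans (ENNReal.coe_le_coe.2 hu.2)

theorem abs_sub_gridTime_le {n : ℕ} {ω : Path} {k : ℕ} {t : ℝ≥0}
    (h : gridTime n ω k ≤ t) (h' : (t : ℝ≥0∞) ≤ gridTime n ω (k + 1)) :
    |ω.I t - ω.I (gridTime n ω k).toNNReal| ≤ (2 : ℝ)⁻¹ ^ n := by
  by_contra! hlt
  have he : gridTime n ω (k + 1) = t := le_antisymm (gridTime_succ_le_of_le_abs h hlt.le) h'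
  have := (gridTime_succ_spec (n := n) (ω := ω) (k := k) (by simp [he])).2
  rw [he, ENNReal.toNNReal_coe] at this
  exact hlt.ne' this

theorem gridTime_eq_of_agree (n : ℕ) (k : ℕ) : ∀ ω ω' : Path,
    AgreeUpTo (gridTime n ω k) ω ω' → gridTime n ω k = gridTime n ω' k := by
  induction k with
  | zero => intro ω ω' _; simp [gridTime]
  | succ k ih =>
    have key : ∀ ω ω' : Path, AgreeUpTo (gridTime n ω (k + 1)) ω ω' →
        gridTime n ω' (k + 1) ≤ gridTime n ω (k + 1) := by
      intro ω ω' h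
      rcases eq_or_ne (gridTime n ω (k + 1)) ⊤ with ht | ht
      · rw [ht]; exact le_top
      have hk := ih ω ω' (h.mono (gridTime_le_succ n ω k))
      obtain ⟨h1, h2⟩ := gridTime_succ_spec ht
      rw [h.I_eq (coe_toNNReal_le _), h.I_eq ((coe_toNNReal_le _).trans h1.le), hk] at h2
      rw [hk, ← ENNReal.coe_toNNReal ht] at h1
      rw [← ENNReal.coe_toNNReal ht]
      exact gridTime_succ_le h1 h2
    intro ω ω' h
    exact le_antisymm (key ω' ω (h.symm.mono (key ω ω' h))) (key ω ω' h)

/-- The event that a grid time comes by time `s`, in terms of the values of `I` at countably many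
random times. -/
theorem gridTime_succ_le_iff (n : ℕ) (ω : Path) (k : ℕ) (s : ℝ≥0) :
    gridTime n ω (k + 1) ≤ s ↔ gridTime n ω k ≤ s ∧
      ∀ m : ℕ, ∃ q : ℕ, (2 : ℝ)⁻¹ ^ n - ((m : ℝ) + 1)⁻¹ <
        |ω.I (max (cap (gridTime n ω k) s) (min s (TopologicalSpace.denseSeq ℝ≥0 q))) -
          ω.I (cap (gridTime n ω k) s)| := by
  set g := gridTime n ω k with hg
  set D : ℝ≥0 → ℝ := fun u => |ω.I (max (cap g s) (min s u)) - ω.I (cap g s)| with hD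
  have hDc : Continuous D := by
    have : Continuous fun u : ℝ≥0 => max (cap g s) (min s u) := by fun_prop
    exact ((ω.continuous_I.comp this).sub continuous_const).abs
  have hpos : (0 : ℝ) < (2 : ℝ)⁻¹ ^ n := by positivity
  constructor
  · intro h
    have hgs : g ≤ s := (gridTime_le_succ n ω k).trans h
    refine ⟨hgs, fun m => ?_⟩
    have ht : gridTime n ω (k + 1) ≠ ⊤ := ne_top_of_le_ne_top ENNReal.coe_ne_top h
    obtain ⟨h1, h2⟩ := gridTime_succ_spec ht
    set u := (gridTime n ω (k + 1)).toNNReal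
    have hus : u ≤ s := toNNReal_le_of_le_coe h
    have hgu : g.toNNReal ≤ u := ENNReal.toNNReal_mono ht h1.le
    have hDu : D u = (2 : ℝ)⁻¹ ^ n := by
      simp only [hD]
      rw [cap_of_ge hgs, min_eq_right hus, max_eq_right hgu, h2]
    have hopen : IsOpen {v | (2 : ℝ)⁻¹ ^ n - ((m : ℝ) + 1)⁻¹ < D v} :=
      isOpen_lt continuous_const hDc
    obtain ⟨q, hq⟩ := (TopologicalSpace.denseRange_denseSeq ℝ≥0).exists_mem_open hopen
      ⟨u, by
        have : (0 : ℝ) < ((m : ℝ) + 1)⁻¹ := by positivity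
        simp only [Set.mem_ofPred_eq, hDu]; linarith⟩
    exact ⟨q, hq⟩
  · rintro ⟨hgs, h⟩
    have hle : g.toNNReal ≤ s := toNNReal_le_of_le_coe hgs
    obtain ⟨u, hu, hmax⟩ := (isCompact_Icc (a := (0 : ℝ≥0)) (b := s)).exists_isMaxOn
      ⟨0, by simp⟩ hDc.continuousOn
    have hbig : (2 : ℝ)⁻¹ ^ n ≤ D u := by
      refine le_of_forall_pos_le_add fun e he => ?_
      obtain ⟨m, hm⟩ := exists_nat_one_div_lt he
      obtain ⟨q, hq⟩ := h m
      set d := TopologicalSpace.denseSeq ℝ≥0 q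
      have h1 : D (min s d) ≤ D u := hmax ⟨zero_le, min_le_left _ _⟩
      have h2 : D (min s d) = D d := by simp [hD]
      rw [one_div] at hm
      have h3 : (2 : ℝ)⁻¹ ^ n - ((m : ℝ) + 1)⁻¹ < D d := hq
      linarith
    have hmaxle : max (cap g s) (min s u) ≤ s := max_le (cap_le_right _ _) (min_le_left _ _)
    refine (gridTime_succ_le_of_le_abs (t := max (cap g s) (min s u)) ?_ ?_).trans
      (ENNReal.coe_le_coe.2 hmaxle)
    · rw [← hg]
      refine le_trans ?_ (ENNReal.coe_le_coe.2 (le_max_left _ _))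
      rw [coe_cap, min_eq_left hgs]
    · rw [← hg]
      simp only [hD] at hbig
      rwa [cap_of_ge hgs] at hbig ⊢

theorem measurable_gridTime (n : ℕ) (k : ℕ) : Measurable fun ω => gridTime n ω k := by
  induction k with
  | zero => simp only [gridTime]; exact measurable_const
  | succ k ih =>
    refine measurable_of_Iic fun x => ?_
    rcases eq_or_ne x ⊤ with rfl | hx
    · simp
    lift x to ℝ≥0 using hx
    have hset : (fun ω => gridTime n ω (k + 1)) ⁻¹' Set.Iic (x : ℝ≥0∞) =
        {ω | gridTime n ω k ≤ x} ∩ ⋂ m : ℕ, ⋃ q : ℕ, {ω | (2 : ℝ)⁻¹ ^ n - ((m : ℝ) + 1)⁻¹ <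
        |ω.I (max (cap (gridTime n ω k) x) (min x (TopologicalSpace.denseSeq ℝ≥0 q))) -
          ω.I (cap (gridTime n ω k) x)|} := by
      ext ω
      simp only [Set.mem_preimage, Set.mem_Iic, Set.mem_inter_iff, Set.mem_ofPred_eq,
        Set.mem_iInter, Set.mem_iUnion]
      exact gridTime_succ_le_iff n ω k x
    rw [hset]
    have hc : Measurable fun ω => cap (gridTime n ω k) x := measurable_cap ih measurable_const
    refine (measurableSet_le ih measurable_const).inter (MeasurableSet.iInter fun m =>
      MeasurableSet.iUnion fun q => measurableSet_lt measurable_const ?_)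
    exact ((measurable_I_comp (hc.max measurable_const)).sub (measurable_I_comp hc)).abs

theorem tendsto_gridTime (n : ℕ) (ω : Path) : Tendsto (gridTime n ω) atTop (𝓝 ⊤) := by
  have hmono : Monotone (gridTime n ω) := monotone_nat_of_le_succ (gridTime_le_succ n ω)
  have hlim := tendsto_atTop_iSup hmono
  suffices h : (⨆ k, gridTime n ω k) = ⊤ by rwa [h] at hlim
  by_contra hne
  have hfin : ∀ k, gridTime n ω k ≠ ⊤ := fun k =>
    ne_top_of_le_ne_top hne (le_iSup (gridTime n ω) k)
  have h1 : Tendsto (fun k => (gridTime n ω k).toNNReal) atTop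
      (𝓝 (⨆ k, gridTime n ω k).toNNReal) := (ENNReal.tendsto_toNNReal hne).comp hlim
  have h2 : Tendsto (fun k => ω.I (gridTime n ω k).toNNReal) atTop
      (𝓝 (ω.I (⨆ k, gridTime n ω k).toNNReal)) := (ω.continuous_I.tendsto _).comp h1
  have h3 := ((h2.comp (tendsto_add_atTop_nat 1)).sub h2).abs
  simp only [sub_self, abs_zero, Function.comp_def] at h3
  -- the increments of `I` between consecutive times, all equal to `2⁻ⁿ`, would tend to zero
  have h4 : Tendsto (fun _ : ℕ => (2 : ℝ)⁻¹ ^ n) atTop (𝓝 0) :=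
    h3.congr fun k => (gridTime_succ_spec (hfin (k + 1))).2
  have h5 := tendsto_nhds_unique h4 tendsto_const_nhds
  have : (0 : ℝ) < (2 : ℝ)⁻¹ ^ n := by positivity
  linarith

/-- The grid times of level `n` as a partition. -/
noncomputable def grid (n : ℕ) : Partition where
  τ k ω := gridTime n ω k
  zero ω := by simp [gridTime]
  isStopTime k := ⟨measurable_gridTime n k, gridTime_eq_of_agree n k⟩
  mono k ω := gridTime_le_succ n ω k
  tendsto ω := tendsto_gridTime n ω

/-! ### Refinements of partitions -/

namespace Partition

theorem count_le {P : Partition} {t : ℝ≥0} {ω : Path} {N : ℕ} (h : (t : ℝ≥0∞) < P.τ N ω) :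
    P.count t ω ≤ N := by
  classical
  exact Nat.find_min' _ h

/-- `R` refines `P`, and the `n`th interval of `R` lies in the `i n`th interval of `P`. -/
structure Refines (R P : Partition) (i : ℕ → Path → ℕ) : Prop where
  zero : ∀ ω, i 0 ω = 0
  step : ∀ n ω, i (n + 1) ω = i n ω ∨ i (n + 1) ω = i n ω + 1
  lower : ∀ n ω, P.τ (i n ω) ω ≤ R.τ n ω
  upper : ∀ n ω, R.τ (n + 1) ω ≤ P.τ (i n ω + 1) ω
  measurable : ∀ n, Measurable (i n)
  eq_of_agree : ∀ n ω ω', AgreeUpTo (R.τ n ω) ω ω' → i n ω = i n ω'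

theorem measurable_comp_index {X : Type*} [MeasurableSpace X] {f : ℕ → Path → X}
    (hf : ∀ k, Measurable (f k)) {i : Path → ℕ} (hi : Measurable i) :
    Measurable fun ω => f (i ω) ω :=
  (measurable_from_prod_countable_right (f := fun p : ℕ × Path => f p.1 p.2) hf).comp
    (hi.prodMk measurable_id)

namespace Refines

variable {R P : Partition} {i : ℕ → Path → ℕ}

theorem le (hR : R.Refines P i) (n : ℕ) (ω : Path) : i n ω ≤ n := by
  induction n with
  | zero => simp [hR.zero]
  | succ n ih => rcases hR.step n ω with h | h <;> omega

theorem adapted (hR : R.Refines P i) {h : ℕ → Path → ℝ} (hh : P.Adapted h) :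
    R.Adapted fun n ω => h (i n ω) ω where
  measurable n := measurable_comp_index hh.measurable (hR.measurable n)
  eq_of_agree n ω ω' ha := by
    rw [← hR.eq_of_agree n ω ω' ha]
    exact hh.eq_of_agree _ ω ω' (ha.mono (hR.lower n ω))

theorem bounded (hR : R.Refines P i) {h : ℕ → Path → ℝ}
    (hh : ∀ k, ∃ C : ℝ, ∀ ω, |h k ω| ≤ C) (n : ℕ) : ∃ C : ℝ, ∀ ω, |h (i n ω) ω| ≤ C := by
  choose C hC using hh
  refine ⟨∑ k ∈ Finset.range (n + 1), |C k|, fun ω => (hC (i n ω) ω).trans ?_⟩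
  refine (le_abs_self _).trans (Finset.single_le_sum (f := fun k => |C k|)
    (fun k _ => abs_nonneg _) ?_)
  simpa [Nat.lt_succ_iff] using hR.le n ω

/-- A step function has the same integral over a finer partition. -/
theorem integral_eq (hR : R.Refines P i) (h : ℕ → Path → ℝ) (t : ℝ≥0) (ω : Path) :
    R.integral (fun n ω => h (i n ω) ω) t ω = P.integral h t ω := by
  have key : ∀ N, ∑ k ∈ Finset.range N, h (i k ω) ω * R.incr k t ω =
      ∑ k ∈ Finset.range (i N ω), h k ω * P.incr k t ω +
        h (i N ω) ω * (ω.I (cap (R.τ N ω) t) - ω.I (cap (P.τ (i N ω) ω) t)) := by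
    intro N
    induction N with
    | zero => simp [hR.zero, R.zero, P.zero]
    | succ N ih =>
      rw [Finset.sum_range_succ, ih]
      rcases hR.step N ω with hs | hs
      · rw [hs, incr]; ring
      · -- the next time of `R` is then exactly the next time of `P`
        have he : R.τ (N + 1) ω = P.τ (i N ω + 1) ω := by
          refine le_antisymm (hR.upper N ω) ?_
          rw [← hs]; exact hR.lower _ ω
        rw [hs, Finset.sum_range_succ, he, incr, incr, he]; ring
  set N := R.count t ω
  have h1 : (t : ℝ≥0∞) < R.τ N ω := R.lt_of_count_le le_rfl
  have h2 : (t : ℝ≥0∞) < P.τ (i N ω + 1) ω := (h1.trans_le (R.mono N ω)).trans_le (hR.upper N ω)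
  rw [integral, key N, P.integral_eq_sum h (count_le h2), Finset.sum_range_succ]
  congr 2
  rw [incr, cap_of_le h1.le, cap_of_le h2.le]

end Refines

/-- The state of the merging of `P` and `Q`: how many times of `P` and of `Q` have been used. At
each step the earlier one of the two next times is used. -/
noncomputable def mergeState (P Q : Partition) : ℕ → Path → ℕ × ℕ
  | 0, _ => (0, 0)
  | n + 1, ω =>
    open Classical in
    if P.τ ((mergeState P Q n ω).1 + 1) ω ≤ Q.τ ((mergeState P Q n ω).2 + 1) ω then
      ((mergeState P Q n ω).1 + 1, (mergeState P Q n ω).2)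
    else ((mergeState P Q n ω).1, (mergeState P Q n ω).2 + 1)

/-- The `n`th time of the merged partition. -/
noncomputable def mergeTime (P Q : Partition) (n : ℕ) (ω : Path) : ℝ≥0∞ :=
  max (P.τ (mergeState P Q n ω).1 ω) (Q.τ (mergeState P Q n ω).2 ω)

variable (P Q : Partition)

theorem mergeState_step (n : ℕ) (ω : Path) :
    (P.τ ((mergeState P Q n ω).1 + 1) ω ≤ Q.τ ((mergeState P Q n ω).2 + 1) ω ∧
      mergeState P Q (n + 1) ω = ((mergeState P Q n ω).1 + 1, (mergeState P Q n ω).2)) ∨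
    (Q.τ ((mergeState P Q n ω).2 + 1) ω < P.τ ((mergeState P Q n ω).1 + 1) ω ∧
      mergeState P Q (n + 1) ω = ((mergeState P Q n ω).1, (mergeState P Q n ω).2 + 1)) := by
  by_cases h : P.τ ((mergeState P Q n ω).1 + 1) ω ≤ Q.τ ((mergeState P Q n ω).2 + 1) ω
  · exact Or.inl ⟨h, by rw [mergeState, if_pos h]⟩
  · exact Or.inr ⟨not_le.1 h, by rw [mergeState, if_neg h]⟩

theorem mergeState_sum (n : ℕ) (ω : Path) :
    (mergeState P Q n ω).1 + (mergeState P Q n ω).2 = n := by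
  induction n with
  | zero => simp [mergeState]
  | succ n ih =>
    rcases mergeState_step P Q n ω with ⟨-, h⟩ | ⟨-, h⟩ <;> rw [h] <;> simp <;> omega

theorem mergeTime_le (n : ℕ) (ω : Path) :
    mergeTime P Q n ω ≤ P.τ ((mergeState P Q n ω).1 + 1) ω ∧
      mergeTime P Q n ω ≤ Q.τ ((mergeState P Q n ω).2 + 1) ω := by
  induction n with
  | zero => simp [mergeTime, mergeState, P.zero, Q.zero]
  | succ n ih =>
    rw [mergeTime] at ih ⊢
    simp only [max_le_iff] at ih ⊢
    rcases mergeState_step P Q n ω with ⟨h1, h⟩ | ⟨h1, h⟩ <;> rw [h]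
    · exact ⟨⟨P.mono _ ω, ih.1.2.trans (P.mono _ ω)⟩, h1, ih.2.2⟩
    · exact ⟨⟨ih.1.1, h1.le⟩, ih.2.1.trans (Q.mono _ ω), Q.mono _ ω⟩

theorem mergeTime_succ (n : ℕ) (ω : Path) :
    mergeTime P Q (n + 1) ω =
      min (P.τ ((mergeState P Q n ω).1 + 1) ω) (Q.τ ((mergeState P Q n ω).2 + 1) ω) := by
  have ih := mergeTime_le P Q n ω
  rw [mergeTime] at ih ⊢
  simp only [max_le_iff] at ih
  rcases mergeState_step P Q n ω with ⟨h1, h⟩ | ⟨h1, h⟩ <;> rw [h]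
  · rw [min_eq_left h1, max_eq_left ih.1.2]
  · rw [min_eq_right h1.le, max_eq_right ih.2.1]

theorem mergeTime_mono (n : ℕ) (ω : Path) : mergeTime P Q n ω ≤ mergeTime P Q (n + 1) ω := by
  rw [mergeTime_succ]
  exact le_min (mergeTime_le P Q n ω).1 (mergeTime_le P Q n ω).2

theorem mergeState_eq_of_agree (n : ℕ) (ω ω' : Path)
    (ha : AgreeUpTo (mergeTime P Q n ω) ω ω') : mergeState P Q n ω = mergeState P Q n ω' := by
  induction n with
  | zero => rfl
  | succ n ih =>
    have hs := ih (ha.mono (mergeTime_mono P Q n ω))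
    rw [mergeTime_succ] at ha
    have hP := (P.isStopTime ((mergeState P Q n ω).1 + 1)).eq_of_agree
    have hQ := (Q.isStopTime ((mergeState P Q n ω).2 + 1)).eq_of_agree
    -- the comparison of the two next times has the same outcome on both paths
    have hiff : P.τ ((mergeState P Q n ω).1 + 1) ω ≤ Q.τ ((mergeState P Q n ω).2 + 1) ω ↔
        P.τ ((mergeState P Q n ω).1 + 1) ω' ≤ Q.τ ((mergeState P Q n ω).2 + 1) ω' := by
      rcases le_or_gt (P.τ ((mergeState P Q n ω).1 + 1) ω) (Q.τ ((mergeState P Q n ω).2 + 1) ω)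
        with h | h
      · rw [min_eq_left h] at ha
        refine iff_of_true h ?_
        by_contra! hlt
        rw [← hP _ _ ha] at hlt
        have := hQ _ _ (ha.symm.mono hlt.le)
        rw [this] at hlt
        exact hlt.not_ge h
      · rw [min_eq_right h.le] at ha
        refine iff_of_false h.not_ge fun hle => ?_
        rw [← hQ _ _ ha] at hle
        have := hP _ _ (ha.symm.mono hle)
        rw [this] at hle
        exact h.not_ge hle
    simp only [mergeState, ← hs, hiff]

theorem measurable_mergeState (n : ℕ) : Measurable (mergeState P Q n) := by
  classical
  induction n with
  | zero => exact measurable_const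
  | succ n ih =>
    simp only [mergeState]
    have h1 : Measurable fun ω => (mergeState P Q n ω).1 + 1 := ih.fst.add_const 1
    have h2 : Measurable fun ω => (mergeState P Q n ω).2 + 1 := ih.snd.add_const 1
    exact Measurable.ite (measurableSet_le
      (measurable_comp_index (fun k => (P.isStopTime k).measurable) h1)
      (measurable_comp_index (fun k => (Q.isStopTime k).measurable) h2))
      (h1.prodMk ih.snd) (ih.fst.prodMk h2)

/-- The common refinement of two partitions. -/
noncomputable def merge : Partition where
  τ := mergeTime P Q
  zero ω := by simp [mergeTime, mergeState, P.zero, Q.zero]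
  isStopTime n :=
    { measurable := (measurable_comp_index (fun k => (P.isStopTime k).measurable)
        (measurable_mergeState P Q n).fst).max
          (measurable_comp_index (fun k => (Q.isStopTime k).measurable)
            (measurable_mergeState P Q n).snd)
      eq_of_agree := fun ω ω' ha => by
        rw [mergeTime, mergeTime, ← mergeState_eq_of_agree P Q n ω ω' ha,
          (P.isStopTime _).eq_of_agree ω ω' (ha.mono (le_max_left _ _)),
          (Q.isStopTime _).eq_of_agree ω ω' (ha.mono (le_max_right _ _))] }
  mono := mergeTime_mono P Q
  tendsto ω := by
    rw [ENNReal.tendsto_nhds_top_iff_nnreal]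
    intro x
    filter_upwards [eventually_ge_atTop (P.count x ω + Q.count x ω)] with n hn
    have hs := mergeState_sum P Q n ω
    rw [mergeTime, lt_max_iff]
    rcases le_or_gt (P.count x ω) (mergeState P Q n ω).1 with h | h
    · exact Or.inl (P.lt_of_count_le h)
    · exact Or.inr (Q.lt_of_count_le (by omega))

theorem merge_refines_left : (merge P Q).Refines P fun n ω => (mergeState P Q n ω).1 where
  zero ω := rfl
  step n ω := by rcases mergeState_step P Q n ω with ⟨-, h⟩ | ⟨-, h⟩ <;> simp [h]
  lower n ω := le_max_left _ _
  upper n ω := (mergeTime_succ P Q n ω).trans_le (min_le_left _ _)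
  measurable n := (measurable_mergeState P Q n).fst
  eq_of_agree n ω ω' ha := congrArg Prod.fst (mergeState_eq_of_agree P Q n ω ω' ha)

theorem merge_refines_right : (merge P Q).Refines Q fun n ω => (mergeState P Q n ω).2 where
  zero ω := rfl
  step n ω := by rcases mergeState_step P Q n ω with ⟨-, h⟩ | ⟨-, h⟩ <;> simp [h]
  lower n ω := le_max_right _ _
  upper n ω := (mergeTime_succ P Q n ω).trans_le (min_le_right _ _)
  measurable n := (measurable_mergeState P Q n).snd
  eq_of_agree n ω ω' ha := congrArg Prod.snd (mergeState_eq_of_agree P Q n ω ω' ha)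

end Partition

/-! ### Gain processes -/

/-- The gains of the simple strategies that trade only in `I`. -/
def IsGain (g : ℝ≥0 → Path → ℝ) : Prop :=
  ∃ (P : Partition) (h : ℕ → Path → ℝ), P.Adapted h ∧ (∀ k, ∃ C : ℝ, ∀ ω, |h k ω| ≤ C) ∧
    ∀ t ω, g t ω = P.integral h t ω

/-- The strategies are added by carrying both out on a common refinement. -/
theorem IsGain.add {g g' : ℝ≥0 → Path → ℝ} (hg : IsGain g) (hg' : IsGain g') :
    IsGain fun t ω => g t ω + g' t ω := by
  obtain ⟨P, h, ha, hb, he⟩ := hg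
  obtain ⟨P', h', ha', hb', he'⟩ := hg'
  have hl := Partition.merge_refines_left P P'
  have hr := Partition.merge_refines_right P P'
  refine ⟨P.merge P', _, (hl.adapted ha).add (hr.adapted ha'), fun k => ?_, fun t ω => ?_⟩
  · obtain ⟨C, hC⟩ := hl.bounded hb k
    obtain ⟨C', hC'⟩ := hr.bounded hb' k
    exact ⟨C + C', fun ω => (abs_add_le _ _).trans (add_le_add (hC ω) (hC' ω))⟩
  · beta_reduce
    rw [he, he', ← hl.integral_eq, ← hr.integral_eq]
    simp only [Partition.integral, add_mul, Finset.sum_add_distrib]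

theorem IsGain.const_mul {g : ℝ≥0 → Path → ℝ} (hg : IsGain g) (r : ℝ) :
    IsGain fun t ω => r * g t ω := by
  obtain ⟨P, h, ha, hb, he⟩ := hg
  refine ⟨P, _, ha.const_mul r, fun k => ?_, fun t ω => ?_⟩
  · obtain ⟨C, hC⟩ := hb k
    exact ⟨|r| * C, fun ω => by rw [abs_mul]; exact mul_le_mul_of_nonneg_left (hC ω) (abs_nonneg r)⟩
  · simp only [he, Partition.integral, Finset.mul_sum, mul_assoc]

theorem IsGain.zero_time {g : ℝ≥0 → Path → ℝ} (hg : IsGain g) (ω : Path) : g 0 ω = 0 := by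
  obtain ⟨P, h, -, -, he⟩ := hg
  simp [he, Partition.integral, Partition.incr_zero_time]

theorem isGain_zero : IsGain fun _ _ => 0 :=
  ⟨grid 0, fun _ _ => 0, ⟨fun _ => measurable_const, fun _ _ _ _ => rfl⟩,
    fun _ => ⟨0, by simp⟩, fun t ω => by simp [Partition.integral]⟩

theorem IsGain.isTestSupermartingale {g : ℝ≥0 → Path → ℝ} (hg : IsGain g) {c : ℝ}
    (hpos : ∀ t ω, 0 ≤ c + g t ω) :
    IsTestSupermartingale fun t ω => ((c + g t ω : ℝ) : EReal) := by
  obtain ⟨P, h, ha, hb, he⟩ := hg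
  let G : SimpleStrategy :=
    { τ := P.τ
      h := fun n ω => (h n ω, 0)
      isStopTime := P.isStopTime
      mono := P.mono
      tendsto := P.tendsto
      bounded := fun n => by
        obtain ⟨C, hC⟩ := hb n
        refine ⟨C, fun ω => ?_⟩
        rw [Prod.norm_def, norm_zero, Real.norm_eq_abs, max_eq_left (abs_nonneg _)]
        exact hC ω
      adapted := fun n => ⟨(ha.measurable n).prodMk measurable_const, fun ω ω' hag => by
        rw [ha.eq_of_agree n ω ω' hag]⟩ }
  have hG : ∀ t ω, G.capital c t ω = c + g t ω := by
    intro t ω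
    have hgain : ∀ n, G.gain n t ω = h n ω * P.incr n t ω := fun n => by
      simp [SimpleStrategy.gain, G, Partition.incr]
    rw [SimpleStrategy.capital, he, Partition.integral,
      tsum_eq_sum (s := Finset.range (P.count t ω))]
    · simp only [hgain]
    · intro n hn
      rw [hgain, P.incr_eq_zero (P.lt_of_count_le (by simpa using hn)).le, mul_zero]
  have := IsTestSupermartingale.simple G c fun t ω => by rw [hG]; exact hpos t ω
  simpa only [hG] using this

/-! ### Multiplicative strategies -/

namespace Partition

/-- The capital at time `t`, when only the first `N` intervals are traded, of the strategy that
starts from `1` and holds on the `k`th interval `b k` units of the index per unit of capital owned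
at its beginning. -/
noncomputable def prod (P : Partition) (b : ℕ → Path → ℝ) (N : ℕ) (t : ℝ≥0) (ω : Path) : ℝ :=
  ∏ k ∈ Finset.range N, (1 + b k ω * P.incr k t ω)

/-- The capital at time `t` of the strategy with relative positions `b`. -/
noncomputable def wealth (P : Partition) (b : ℕ → Path → ℝ) (t : ℝ≥0) (ω : Path) : ℝ :=
  P.prod b (P.count t ω) t ω

/-- The capital at the `k`th time of the partition (on the paths where that time is infinite, the
initial capital). -/
noncomputable def stake (P : Partition) (b : ℕ → Path → ℝ) (k : ℕ) (ω : Path) : ℝ :=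
  P.prod b k (P.τ k ω).toNNReal ω

/-- The index moves by at most `δ` during each interval of the partition. -/
def HasMesh (P : Partition) (δ : ℝ) : Prop := ∀ k t ω, |P.incr k t ω| ≤ δ

variable {P : Partition} {b : ℕ → Path → ℝ} {B δ : ℝ}

theorem prod_succ (N : ℕ) (t : ℝ≥0) (ω : Path) :
    P.prod b (N + 1) t ω = P.prod b N t ω * (1 + b N ω * P.incr N t ω) :=
  Finset.prod_range_succ _ _

theorem wealth_eq_prod {t : ℝ≥0} {ω : Path} {N : ℕ} (hN : P.count t ω ≤ N) :
    P.wealth b t ω = P.prod b N t ω := by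
  refine Finset.prod_subset (Finset.range_mono hN) fun k _ hk => ?_
  rw [P.incr_eq_zero (P.lt_of_count_le (by simpa using hk)).le, mul_zero, add_zero]

theorem stake_eq_prod {k : ℕ} {t : ℝ≥0} {ω : Path} (h : P.τ k ω ≤ t) :
    P.stake b k ω = P.prod b k t ω := by
  unfold stake prod
  refine Finset.prod_congr rfl fun j hj => ?_
  rw [P.incr_toNNReal (Finset.mem_range.1 hj) h]

theorem abs_mul_incr_le (hδ : P.HasMesh δ) (hb : ∀ k ω, |b k ω| ≤ B) (hB : B * δ ≤ 1 / 2)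
    (k : ℕ) (t : ℝ≥0) (ω : Path) : |b k ω * P.incr k t ω| ≤ 1 / 2 := by
  rw [abs_mul]
  refine le_trans (mul_le_mul (hb k ω) (hδ k t ω) (abs_nonneg _) ?_) hB
  exact (abs_nonneg _).trans (hb k ω)

theorem prod_pos (hδ : P.HasMesh δ) (hb : ∀ k ω, |b k ω| ≤ B) (hB : B * δ ≤ 1 / 2)
    (N : ℕ) (t : ℝ≥0) (ω : Path) : 0 < P.prod b N t ω := by
  refine Finset.prod_pos fun k _ => ?_
  have := (abs_le.1 (abs_mul_incr_le hδ hb hB k t ω)).1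
  linarith

theorem stake_le (hδ : P.HasMesh δ) (hb : ∀ k ω, |b k ω| ≤ B) (hB : B * δ ≤ 1 / 2)
    (k : ℕ) (ω : Path) : P.stake b k ω ≤ 2 ^ k := by
  rw [stake, prod, ← Finset.card_range k, ← Finset.prod_const, Finset.card_range]
  refine Finset.prod_le_prod (fun j _ => ?_) fun j _ => ?_ <;>
  have := abs_le.1 (abs_mul_incr_le hδ hb hB j (P.τ k ω).toNNReal ω) <;> linarith

theorem Adapted.stake (hb : P.Adapted b) : P.Adapted (P.stake b) where
  measurable k := by
    unfold Partition.stake Partition.prod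
    refine Finset.measurable_prod _ fun j _ => ?_
    have hu : Measurable fun ω => (P.τ k ω).toNNReal :=
      (P.isStopTime k).measurable.ennreal_toNNReal
    refine ((hb.measurable j).mul (Measurable.sub ?_ ?_)).const_add 1 <;>
    exact measurable_I_comp (measurable_cap (P.isStopTime _).measurable hu)
  eq_of_agree k ω ω' ha := by
    have hτ : ∀ j ≤ k, P.τ j ω = P.τ j ω' := fun j hj =>
      (P.isStopTime j).eq_of_agree ω ω' (ha.mono (P.monotone ω hj))
    have hI : ∀ j ≤ k, ω.I (cap (P.τ j ω) (P.τ k ω).toNNReal) =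
        ω'.I (cap (P.τ j ω') (P.τ k ω').toNNReal) := by
      intro j hj
      rw [← hτ j hj, ← hτ k le_rfl]
      exact ha.I_eq ((ENNReal.coe_le_coe.2 (cap_le_right _ _)).trans (coe_toNNReal_le _))
    unfold Partition.stake Partition.prod
    refine Finset.prod_congr rfl fun j hj => ?_
    have hj : j < k := Finset.mem_range.1 hj
    rw [incr, incr, hI j hj.le, hI (j + 1) hj,
      hb.eq_of_agree j ω ω' (ha.mono (P.monotone ω hj.le))]

/-- The strategy with relative positions `b` holds `stake b k * b k` units of the index. -/
theorem isGain_wealth (hb : P.Adapted b) (hδ : P.HasMesh δ) (hB : ∀ k ω, |b k ω| ≤ B)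
    (hBδ : B * δ ≤ 1 / 2) : IsGain fun t ω => P.wealth b t ω - 1 := by
  have hs := hb.stake
  refine ⟨P, fun k ω => P.stake b k ω * b k ω, ⟨fun k => (hs.measurable k).mul (hb.measurable k),
    fun k ω ω' ha => by rw [hs.eq_of_agree k ω ω' ha, hb.eq_of_agree k ω ω' ha]⟩,
    fun k => ⟨2 ^ k * B, fun ω => ?_⟩, fun t ω => ?_⟩
  · have hpos : 0 < P.stake b k ω := prod_pos hδ hB hBδ _ _ _
    rw [abs_mul, abs_of_pos hpos]
    exact mul_le_mul (stake_le hδ hB hBδ k ω) (hB k ω) (abs_nonneg _) (by positivity)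
  · have key : ∀ k, P.stake b k ω * b k ω * P.incr k t ω =
        P.prod b (k + 1) t ω - P.prod b k t ω := by
      intro k
      rcases le_total (P.τ k ω) t with h | h
      · rw [stake_eq_prod h, prod_succ]; ring
      · rw [prod_succ, P.incr_eq_zero h]; ring
    simp only [integral, key]
    rw [Finset.sum_range_sub fun k => P.prod b k t ω]
    simp [wealth, prod]

open Classical in
/-- The positions `b`, abandoned from the first time of the partition at which the capital has
reached `C`. -/
noncomputable def abandonAt (P : Partition) (b : ℕ → Path → ℝ) (C : ℝ) (k : ℕ) (ω : Path) : ℝ :=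
  if ∀ j ≤ k, P.stake b j ω < C then b k ω else 0

theorem Adapted.abandonAt (hb : P.Adapted b) (C : ℝ) : P.Adapted (P.abandonAt b C) where
  measurable k := by
    classical
    refine Measurable.ite ?_ (hb.measurable k) measurable_const
    have : {ω | ∀ j ≤ k, P.stake b j ω < C} = ⋂ j ≤ k, {ω | P.stake b j ω < C} := by
      ext ω; simp
    rw [this]
    exact MeasurableSet.iInter fun j => MeasurableSet.iInter fun _ =>
      measurableSet_lt (hb.stake.measurable j) measurable_const
  eq_of_agree k ω ω' ha := by
    have hs : (∀ j ≤ k, P.stake b j ω < C) ↔ ∀ j ≤ k, P.stake b j ω' < C :=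
      forall₂_congr fun j hj => by
        rw [hb.stake.eq_of_agree j ω ω' (ha.mono (P.monotone ω hj))]
    simp only [Partition.abandonAt, hs, hb.eq_of_agree k ω ω' ha]

theorem abs_abandonAt_le (hB : ∀ k ω, |b k ω| ≤ B) (C : ℝ) (k : ℕ) (ω : Path) :
    |P.abandonAt b C k ω| ≤ B := by
  unfold abandonAt
  split_ifs
  · exact hB k ω
  · rw [abs_zero]; exact (abs_nonneg _).trans (hB k ω)

/-- Between two times of the partition the capital changes by a factor of at most two. -/
theorem exists_prod_le_stake (hδ : P.HasMesh δ) (hB : ∀ k ω, |b k ω| ≤ B)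
    (hBδ : B * δ ≤ 1 / 2) (N : ℕ) (s : ℝ≥0) (ω : Path) :
    ∃ j, P.τ j ω ≤ s ∧ P.prod b N s ω ≤ 2 * P.stake b j ω := by
  induction N with
  | zero => exact ⟨0, by simp [P.zero], by simp [prod, stake]⟩
  | succ N ih =>
    rcases le_total (P.τ N ω) s with h | h
    · refine ⟨N, h, ?_⟩
      rw [stake_eq_prod h, prod_succ, mul_comm 2]
      have := (abs_le.1 (abs_mul_incr_le hδ hB hBδ N s ω)).2
      exact mul_le_mul_of_nonneg_left (by linarith) (prod_pos hδ hB hBδ _ _ _).le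
    · rwa [prod_succ, P.incr_eq_zero h, mul_zero, add_zero, mul_one]

/-- The stopped strategy keeps a level that the strategy without stopping has reached twice
over. -/
theorem le_wealth_abandonAt (hδ : P.HasMesh δ) (hB : ∀ k ω, |b k ω| ≤ B) (hBδ : B * δ ≤ 1 / 2)
    {C : ℝ} {s t : ℝ≥0} (hst : s ≤ t) {ω : Path} (hC : 2 * C ≤ P.wealth b s ω) :
    C ≤ P.wealth (P.abandonAt b C) t ω := by
  classical
  obtain ⟨j, hj, hj'⟩ := exists_prod_le_stake hδ hB hBδ (P.count s ω) s ω
  have hex : ∃ j, C ≤ P.stake b j ω := ⟨j, by rw [wealth] at hC; linarith⟩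
  set κ := Nat.find hex
  have hκt : P.τ κ ω ≤ t := by
    refine (P.monotone ω (Nat.find_min' hex (m := j) ?_)).trans
      (hj.trans (ENNReal.coe_le_coe.2 hst))
    rw [wealth] at hC; linarith
  have hbelow : ∀ k < κ, P.abandonAt b C k ω = b k ω := fun k hk =>
    if_pos fun i hi => not_le.1 (Nat.find_min hex (hi.trans_lt hk))
  have habove : ∀ k, κ ≤ k → P.abandonAt b C k ω = 0 := fun k hk =>
    if_neg fun h => (h κ hk).not_ge (Nat.find_spec hex)
  have hprod : P.prod (P.abandonAt b C) (max (P.count t ω) κ) t ω = P.prod b κ t ω := by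
    rw [prod, ← Finset.prod_subset (Finset.range_mono (le_max_right (P.count t ω) κ))]
    · exact Finset.prod_congr rfl fun k hk => by rw [hbelow k (Finset.mem_range.1 hk)]
    · intro k _ hk
      rw [habove k (by simpa using hk), zero_mul, add_zero]
  rw [wealth_eq_prod (le_max_left _ κ), hprod, ← stake_eq_prod hκt]
  exact Nat.find_spec hex

theorem exists_isGain_of_wealth (hb : P.Adapted b) (hδ : P.HasMesh δ)
    (hB : ∀ k ω, |b k ω| ≤ B) (hBδ : B * δ ≤ 1 / 2) (C : ℝ) :
    ∃ g, IsGain g ∧ (∀ t ω, 0 ≤ 1 + g t ω) ∧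
      ∀ s t ω, s ≤ t → 2 * C ≤ P.wealth b s ω → C ≤ 1 + g t ω := by
  have hB' := abs_abandonAt_le (P := P) hB C
  refine ⟨_, isGain_wealth (hb.abandonAt C) hδ hB' hBδ, fun t ω => ?_, fun s t ω hst hC => ?_⟩
  · rw [add_sub_cancel]; exact (prod_pos hδ hB' hBδ _ _ _).le
  · rw [add_sub_cancel]; exact le_wealth_abandonAt hδ hB hBδ hst hC

end Partition

/-! ### Mixtures -/

/-- The mixture, with weights `2⁻⁽ⁿ⁺¹⁾`, of capital processes is infinite wherever the `n`th
process is at least `2ⁿ` for infinitely many `n`. -/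
theorem exists_isTestSupermartingale_eq_top {g : ℕ → ℝ≥0 → Path → ℝ} (hg : ∀ n, IsGain (g n))
    (hpos : ∀ n t ω, 0 ≤ 1 + g n t ω) :
    ∃ Z : PriceProcess, IsTestSupermartingale Z ∧ (∀ ω, Z 0 ω = 1) ∧
      ∀ t ω, (∃ᶠ n in atTop, (2 : ℝ) ^ n ≤ 1 + g n t ω) → Z t ω = ⊤ := by
  set G : ℕ → ℝ≥0 → Path → ℝ := fun N t ω =>
    ∑ n ∈ Finset.range N, (2 : ℝ)⁻¹ ^ (n + 1) * g n t ω with hG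
  have hgain : ∀ N, IsGain (G N) := by
    intro N
    induction N with
    | zero => simpa [hG] using isGain_zero
    | succ N ih =>
      have := ih.add ((hg N).const_mul ((2 : ℝ)⁻¹ ^ (N + 1)))
      simpa only [hG, Finset.sum_range_succ] using this
  have hsum : ∀ N t ω, 1 + G N t ω = (2 : ℝ)⁻¹ ^ N +
      ∑ n ∈ Finset.range N, (2 : ℝ)⁻¹ ^ (n + 1) * (1 + g n t ω) := by
    intro N t ω
    induction N with
    | zero => simp [hG]
    | succ N ih =>
      simp only [hG, Finset.sum_range_succ] at ih ⊢
      rw [← add_assoc, ih, pow_succ]; ring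
  have hterm : ∀ t ω n, 0 ≤ (2 : ℝ)⁻¹ ^ (n + 1) * (1 + g n t ω) := fun t ω n =>
    mul_nonneg (by positivity) (hpos n t ω)
  have hcap : ∀ N t ω, 0 ≤ 1 + G N t ω := fun N t ω => by
    rw [hsum]
    exact add_nonneg (by positivity) (Finset.sum_nonneg fun n _ => hterm t ω n)
  refine ⟨_, .liminf _ fun N => (hgain N).isTestSupermartingale (hcap N), fun ω => ?_,
    fun t ω hfreq => ?_⟩
  · simp [(hgain _).zero_time]
  · refine Tendsto.liminf_eq ?_
    refine EReal.tendsto_coe_nhds_top_iff.2 ?_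
    have hns : ¬ Summable fun n => (2 : ℝ)⁻¹ ^ (n + 1) * (1 + g n t ω) := by
      intro hs
      have hlt := hs.tendsto_atTop_zero.eventually (gt_mem_nhds (show (0 : ℝ) < 2⁻¹ by norm_num))
      obtain ⟨n, hn, hn'⟩ := (hfreq.and_eventually hlt).exists
      have h1 := mul_le_mul_of_nonneg_left hn (show (0 : ℝ) ≤ 2⁻¹ ^ (n + 1) by positivity)
      have h2 : (2 : ℝ)⁻¹ ^ (n + 1) * 2 ^ n = 2⁻¹ := by
        rw [pow_succ, mul_right_comm, ← mul_pow, inv_mul_cancel₀ two_ne_zero, one_pow, one_mul]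
      linarith
    have ht := (not_summable_iff_tendsto_nat_atTop_of_nonneg (hterm t ω)).1 hns
    refine tendsto_atTop_mono (fun N => ?_) ht
    rw [hsum]
    exact le_add_of_nonneg_left (by positivity)

/-! ### Logarithms of the price and of products -/

theorem abs_log_one_add_sub_le {x : ℝ} (hx : |x| ≤ 1 / 2) :
    |Real.log (1 + x) - (x - x ^ 2 / 2)| ≤ 2 * |x| ^ 3 := by
  have h := Real.abs_log_sub_add_sum_range_le (x := -x) (by rw [abs_neg]; linarith) 2
  simp only [Finset.sum_range_succ, Finset.sum_range_zero, abs_neg, sub_neg_eq_add] at h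
  have h2 : |x| ^ (2 + 1) / (1 - |x|) ≤ 2 * |x| ^ 3 := by
    rw [div_le_iff₀ (by linarith)]
    have : 0 ≤ |x| ^ 3 := by positivity
    norm_num
    nlinarith
  refine le_trans (le_of_eq ?_) (h.trans h2)
  congr 1
  norm_num
  ring

theorem log_one_add_bounds {x : ℝ} (hx : |x| ≤ 1 / 8) :
    x - x ^ 2 ≤ Real.log (1 + x) ∧ Real.log (1 + x) ≤ x - x ^ 2 / 4 := by
  have h := abs_le.1 (abs_log_one_add_sub_le (hx.trans (by norm_num)))
  have h3 : 2 * |x| ^ 3 ≤ x ^ 2 / 4 := by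
    rw [← sq_abs x]
    nlinarith [sq_nonneg |x|]
  constructor <;> nlinarith [sq_nonneg x]

/-- `x` is a relative increment of the index, an eighth of the capital is held in it, and `z` is the
relative gain of a bet that is small compared with `x`. The bet costs nothing to second order, as
`(x / 8 + z) ^ 2` is at most an eighth of the term `x ^ 2 / 4` lost by `log (1 + x)`. -/
theorem log_one_add_eighth_add {x z : ℝ} (hx : |x| ≤ 1 / 8) (hz : |z| ≤ |x| / 32) :
    Real.log (1 + x) / 8 + z ≤ Real.log (1 + (x / 8 + z)) := by
  have h1 : |x / 8 + z| ≤ 5 / 32 * |x| := by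
    refine (abs_add_le _ _).trans ?_
    rw [abs_div, abs_of_pos (show (0 : ℝ) < 8 by norm_num)]
    linarith
  have h2 := (log_one_add_bounds (h1.trans (by linarith))).1
  have h3 := (log_one_add_bounds hx).2
  have h4 : (x / 8 + z) ^ 2 ≤ (5 / 32 * |x|) ^ 2 := by
    rw [← sq_abs (x / 8 + z)]
    exact pow_le_pow_left₀ (abs_nonneg _) h1 2
  rw [mul_pow, sq_abs] at h4
  nlinarith [sq_nonneg x]

theorem abs_sum_log_sub_le {ι : Type*} (s : Finset ι) (x : ι → ℝ) {a ρ : ℝ}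
    (hx : ∀ k ∈ s, |x k| ≤ ρ) (ha : |a| * ρ ≤ 1 / 2) :
    |∑ k ∈ s, Real.log (1 + a * x k) - (a * ∑ k ∈ s, x k - a ^ 2 / 2 * ∑ k ∈ s, x k ^ 2)| ≤
      2 * |a| ^ 3 * ρ * ∑ k ∈ s, x k ^ 2 := by
  rw [Finset.mul_sum, Finset.mul_sum, ← Finset.sum_sub_distrib, ← Finset.sum_sub_distrib,
    Finset.mul_sum]
  refine (Finset.abs_sum_le_sum_abs _ _).trans (Finset.sum_le_sum fun k hk => ?_)
  have hax : |a * x k| ≤ 1 / 2 := by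
    rw [abs_mul]
    exact (mul_le_mul_of_nonneg_left (hx k hk) (abs_nonneg a)).trans ha
  have h := abs_log_one_add_sub_le hax
  have e1 : a * x k - (a * x k) ^ 2 / 2 = a * x k - a ^ 2 / 2 * x k ^ 2 := by ring
  rw [e1] at h
  refine h.trans ?_
  rw [abs_mul, mul_pow, ← sq_abs (x k)]
  have : |x k| ^ 3 ≤ ρ * |x k| ^ 2 := by
    rw [pow_succ']
    exact mul_le_mul_of_nonneg_right (hx k hk) (by positivity)
  calc 2 * (|a| ^ 3 * |x k| ^ 3) ≤ 2 * (|a| ^ 3 * (ρ * |x k| ^ 2)) := by gcongr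
    _ = 2 * |a| ^ 3 * ρ * |x k| ^ 2 := by ring

/-- A positive continuous path is bounded away from `0` and `∞` on compact time intervals. -/
theorem Path.exists_bounds (ω : Path) (t : ℝ≥0) :
    ∃ c : ℝ, 0 < c ∧ ∀ s ≤ t, c ≤ ω.I s ∧ ω.I s ≤ c⁻¹ := by
  have hK : IsCompact (Set.Icc 0 t) := isCompact_Icc
  have hne : (Set.Icc 0 t).Nonempty := ⟨0, by simp⟩
  obtain ⟨u, hu, hmin⟩ := hK.exists_isMinOn hne ω.continuous_I.continuousOn
  obtain ⟨v, hv, hmax⟩ := hK.exists_isMaxOn hne ω.continuous_I.continuousOn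
  have hpos : 0 < min (ω.I u) (ω.I v)⁻¹ := lt_min (ω.I_pos u) (inv_pos.2 (ω.I_pos v))
  refine ⟨_, hpos, fun s hs => ?_⟩
  have hs' : s ∈ Set.Icc 0 t := ⟨zero_le, hs⟩
  refine ⟨(min_le_left _ _).trans (hmin hs'), (hmax hs').trans ?_⟩
  rw [le_inv_comm₀ (ω.I_pos v) hpos]
  exact min_le_right _ _

namespace Partition

/-- The relative increment of `I` over the part before time `t` of the `k`th interval. -/
noncomputable def relIncr (P : Partition) (k : ℕ) (t : ℝ≥0) (ω : Path) : ℝ :=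
  P.incr k t ω / ω.I (cap (P.τ k ω) t)

theorem sum_log_one_add_relIncr (P : Partition) (t : ℝ≥0) (ω : Path) :
    ∑ k ∈ Finset.range (P.count t ω), Real.log (1 + P.relIncr k t ω) = Real.log (ω.I t) := by
  have h : ∀ k, Real.log (1 + P.relIncr k t ω) =
      Real.log (ω.I (cap (P.τ (k + 1) ω) t)) - Real.log (ω.I (cap (P.τ k ω) t)) := by
    intro k
    rw [← Real.log_div (ω.I_pos _).ne' (ω.I_pos _).ne', relIncr, incr, sub_div,
      div_self (ω.I_pos _).ne', add_sub_cancel]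
  simp only [h]
  rw [Finset.sum_range_sub fun k => Real.log (ω.I (cap (P.τ k ω) t)),
    cap_of_le (P.lt_of_count_le le_rfl).le, P.zero, zero_cap, ω.I_zero, Real.log_one, sub_zero]

theorem inv_mul_incr (P : Partition) (k : ℕ) (t : ℝ≥0) (ω : Path) :
    (ω.I (P.τ k ω).toNNReal)⁻¹ * P.incr k t ω = P.relIncr k t ω := by
  rcases le_total (P.τ k ω) t with h | h
  · rw [relIncr, cap_of_ge h, inv_mul_eq_div]
  · rw [relIncr, P.incr_eq_zero h, mul_zero, zero_div]

theorem log_wealth {P : Partition} {b : ℕ → Path → ℝ} {t : ℝ≥0} {ω : Path}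
    (h : ∀ k, 0 < 1 + b k ω * P.incr k t ω) :
    Real.log (P.wealth b t ω) =
      ∑ k ∈ Finset.range (P.count t ω), Real.log (1 + b k ω * P.incr k t ω) := by
  rw [wealth, prod]
  exact Real.log_prod fun k _ => (h k).ne'

end Partition

theorem variationApprox_eq_sum (n : ℕ) (t : ℝ≥0) (ω : Path) :
    variationApprox n t ω =
      ∑ k ∈ Finset.range ((grid n).count t ω), (grid n).relIncr k t ω ^ 2 := by
  refine tsum_eq_sum fun k hk => ?_
  have : relIncrement n t ω k = (grid n).relIncr k t ω := rfl
  rw [this, Partition.relIncr,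
    (grid n).incr_eq_zero ((grid n).lt_of_count_le (by simpa using hk)).le]
  simp

theorem growthApprox_eq_sum (n : ℕ) (t : ℝ≥0) (ω : Path) :
    growthApprox n t ω = ∑ k ∈ Finset.range ((grid n).count t ω), (grid n).relIncr k t ω := by
  refine tsum_eq_sum fun k hk => ?_
  have : relIncrement n t ω k = (grid n).relIncr k t ω := rfl
  rw [this, Partition.relIncr,
    (grid n).incr_eq_zero ((grid n).lt_of_count_le (by simpa using hk)).le]
  simp

/-- The reciprocal of the value of `I` at the `k`th grid time of level `n` (of `I 0` where that time is
infinite). -/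
noncomputable def gridInv (n k : ℕ) (ω : Path) : ℝ := (ω.I (gridTime n ω k).toNNReal)⁻¹

theorem growthApprox_eq_integral (n : ℕ) (t : ℝ≥0) (ω : Path) :
    growthApprox n t ω = (grid n).integral (gridInv n) t ω := by
  rw [growthApprox_eq_sum, Partition.integral]
  exact Finset.sum_congr rfl fun k _ => ((grid n).inv_mul_incr k t ω).symm

theorem grid_hasMesh (n : ℕ) : (grid n).HasMesh ((2 : ℝ)⁻¹ ^ n) := by
  intro k t ω
  rcases le_total (gridTime n ω k) t with h | h
  · have : (grid n).incr k t ω =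
        ω.I (cap (gridTime n ω (k + 1)) t) - ω.I (gridTime n ω k).toNNReal := by
      rw [← cap_of_ge h]; rfl
    rw [this]
    refine abs_sub_gridTime_le ?_ ?_ <;> rw [coe_cap]
    · exact le_min (gridTime_le_succ n ω k) h
    · exact min_le_left _ _
  · rw [(grid n).incr_eq_zero h, abs_zero]
    positivity

theorem Partition.Refines.abs_sub_le {R : Partition} {n : ℕ} {i : ℕ → Path → ℕ}
    (hR : R.Refines (grid n) i) {k : ℕ} {ω : Path} {s : ℝ≥0} (h1 : R.τ k ω ≤ s)
    (h2 : (s : ℝ≥0∞) ≤ R.τ (k + 1) ω) :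
    |ω.I s - ω.I (gridTime n ω (i k ω)).toNNReal| ≤ (2 : ℝ)⁻¹ ^ n :=
  abs_sub_gridTime_le ((hR.lower k ω).trans h1) (h2.trans (hR.upper k ω))

theorem Partition.Refines.hasMesh {R : Partition} {n : ℕ} {i : ℕ → Path → ℕ}
    (hR : R.Refines (grid n) i) : R.HasMesh (2 * (2 : ℝ)⁻¹ ^ n) := by
  intro k t ω
  rcases le_total (R.τ k ω) t with h | h
  · have hk := hR.abs_sub_le (k := k) (ω := ω) (s := cap (R.τ k ω) t)
      (by rw [coe_cap]; exact le_min le_rfl h)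
      (by rw [coe_cap]; exact (min_le_left _ _).trans (R.mono k ω))
    have hk' := hR.abs_sub_le (k := k) (ω := ω) (s := cap (R.τ (k + 1) ω) t)
      (by rw [coe_cap]; exact le_min (R.mono k ω) h)
      (by rw [coe_cap]; exact min_le_left _ _)
    rw [abs_le] at hk hk' ⊢
    rw [Partition.incr]
    constructor <;> linarith
  · rw [R.incr_eq_zero h, abs_zero]
    positivity

/-! ### Convergence of the cumulative growth -/

/-- The common refinement of the grids of levels `n` and `n + 1`. -/
noncomputable def doubleGrid (n : ℕ) : Partition := (grid n).merge (grid (n + 1))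

/-- The relative positions, on the common refinement of two consecutive grids, of a
strategy that bets on the difference of the two approximations to the growth of `I`, in the
direction `σ` and with intensity `(3/2) ^ n`. The first term invests an eighth of the capital in
the index. -/
noncomputable def betweenGrids (σ : ℝ) (n k : ℕ) (ω : Path) : ℝ :=
  1 / 8 * (ω.I ((doubleGrid n).τ k ω).toNNReal)⁻¹ +
    σ * (3 / 2) ^ n * (gridInv n ((grid n).mergeState (grid (n + 1)) k ω).1 ω +
      -1 * gridInv (n + 1) ((grid n).mergeState (grid (n + 1)) k ω).2 ω)

theorem adapted_betweenGrids (σ : ℝ) (n : ℕ) : (doubleGrid n).Adapted (betweenGrids σ n) :=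
  ((doubleGrid n).adapted_inv_I.const_mul (1 / 8)).add
    ((((Partition.merge_refines_left (grid n) (grid (n + 1))).adapted
      (grid n).adapted_inv_I).add
      (((Partition.merge_refines_right (grid n) (grid (n + 1))).adapted
        (grid (n + 1)).adapted_inv_I).const_mul (-1))).const_mul (σ * (3 / 2) ^ n))

/-- The size of the bet on the difference of two grid values `v`, `w` close to the current value
`u`, compared with the fraction of the capital held in the index. -/
theorem mul_abs_inv_sub_inv_le {c e l u v w : ℝ} (hc : 0 < c) (hu : 0 < u) (huc : u ≤ c⁻¹)
    (hv : c ≤ v) (hw : c ≤ w) (huv : |u - v| ≤ e) (huw : |u - w| ≤ e) (hl : 0 ≤ l)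
    (hsmall : 64 * (l * e) ≤ c ^ 3) : l * |v⁻¹ - w⁻¹| ≤ u⁻¹ / 32 := by
  have hv0 : 0 < v := hc.trans_le hv
  have hw0 : 0 < w := hc.trans_le hw
  have h1 : |w - v| ≤ 2 * e := by
    rw [abs_le] at huv huw ⊢
    constructor <;> linarith
  have h2 : |v⁻¹ - w⁻¹| ≤ 2 * e / (c * c) := by
    rw [inv_sub_inv hv0.ne' hw0.ne', abs_div, abs_of_pos (mul_pos hv0 hw0)]
    exact div_le_div₀ ((abs_nonneg _).trans h1) h1 (by positivity)
      (mul_le_mul hv hw hc.le hv0.le)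
  have h3 : c ≤ u⁻¹ := (le_inv_comm₀ hu hc).1 huc
  calc l * |v⁻¹ - w⁻¹| ≤ l * (2 * e / (c * c)) := mul_le_mul_of_nonneg_left h2 hl
    _ = 64 * (l * e) / (32 * (c * c)) := by ring
    _ ≤ c ^ 3 / (32 * (c * c)) := by gcongr
    _ = c / 32 := by field_simp
    _ ≤ u⁻¹ / 32 := by linarith

/-- The logarithm of the capital dominates the logarithm of the index value plus the bet on the
difference of two consecutive approximations, as the quadratic cost of the bet is smaller than
the quadratic variation earned by holding a fixed proportion of the capital in the index. -/
theorem le_log_wealth_betweenGrids {σ : ℝ} (hσ : |σ| ≤ 1) {n : ℕ} {t : ℝ≥0} {ω : Path} {c : ℝ}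
    (hc : 0 < c) (hI : ∀ s ≤ t, c ≤ ω.I s ∧ ω.I s ≤ c⁻¹) (hn : 16 * (2 : ℝ)⁻¹ ^ n ≤ c)
    (hn' : 64 * ((3 / 2 : ℝ) ^ n * 2⁻¹ ^ n) ≤ c ^ 3) :
    Real.log (ω.I t) / 8 + σ * (3 / 2) ^ n * (growthApprox n t ω - growthApprox (n + 1) t ω) ≤
      Real.log ((doubleGrid n).wealth (Partition.clip (2 ^ n / 4) (betweenGrids σ n)) t ω) := by
  set P := doubleGrid n
  set b := Partition.clip (2 ^ n / 4) (betweenGrids σ n)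
  have hl : P.Refines (grid n) _ := Partition.merge_refines_left (grid n) (grid (n + 1))
  have hr : P.Refines (grid (n + 1)) _ := Partition.merge_refines_right (grid n) (grid (n + 1))
  set i : ℕ → Path → ℕ := fun k ω => ((grid n).mergeState (grid (n + 1)) k ω).1
  set j : ℕ → Path → ℕ := fun k ω => ((grid n).mergeState (grid (n + 1)) k ω).2
  have he : (0 : ℝ) < 2⁻¹ ^ n := by positivity
  have he' : (2 : ℝ)⁻¹ ^ (n + 1) ≤ 2⁻¹ ^ n := by rw [pow_succ]; linarith
  have he2 : (2 : ℝ) ^ n * 2⁻¹ ^ n = 1 := by rw [← mul_pow]; norm_num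
  have hterm : ∀ k, 0 < 1 + b k ω * P.incr k t ω ∧ Real.log (1 + P.relIncr k t ω) / 8 +
      σ * (3 / 2) ^ n * ((gridInv n (i k ω) ω - gridInv (n + 1) (j k ω) ω) * P.incr k t ω) ≤
        Real.log (1 + b k ω * P.incr k t ω) := by
    intro k
    rcases le_total (t : ℝ≥0∞) (P.τ k ω) with h | h
    · simp [Partition.relIncr, P.incr_eq_zero h]
    have htop : P.τ k ω ≠ ⊤ := ne_top_of_le_ne_top ENNReal.coe_ne_top h
    set r : ℝ≥0 := (P.τ k ω).toNNReal with hrdef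
    have hr0 : (r : ℝ≥0∞) = P.τ k ω := ENNReal.coe_toNNReal htop
    have hrt : r ≤ t := toNNReal_le_of_le_coe h
    have hmem : ∀ q : ℝ≥0∞, q ≤ P.τ k ω → c ≤ ω.I q.toNNReal := fun q hq =>
      (hI _ (toNNReal_le_of_le_coe (hq.trans h))).1
    have hu := hI r hrt
    have hu0 : 0 < ω.I r := ω.I_pos r
    have hD := mul_abs_inv_sub_inv_le (l := (3 / 2 : ℝ) ^ n) hc hu0 hu.2
      (hmem _ (hl.lower k ω)) (hmem _ (hr.lower k ω))
      (hl.abs_sub_le hr0.ge (hr0.trans_le (P.mono k ω)))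
      ((hr.abs_sub_le hr0.ge (hr0.trans_le (P.mono k ω))).trans he') (by positivity) hn'
    change (3 / 2 : ℝ) ^ n * |gridInv n (i k ω) ω - gridInv (n + 1) (j k ω) ω| ≤ _ at hD
    set D := gridInv n (i k ω) ω - gridInv (n + 1) (j k ω) ω
    have hz : |σ * (3 / 2) ^ n * D| ≤ (ω.I r)⁻¹ / 32 := by
      rw [abs_mul, abs_mul, abs_of_pos (show (0 : ℝ) < (3 / 2) ^ n by positivity), mul_assoc]
      exact (mul_le_of_le_one_left (by positivity) hσ).trans hD
    have hbet : betweenGrids σ n k ω = 1 / 8 * (ω.I r)⁻¹ + σ * (3 / 2) ^ n * D := by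
      rw [betweenGrids, neg_one_mul, ← sub_eq_add_neg]
    have hinv : 0 < (ω.I r)⁻¹ := inv_pos.2 hu0
    have hinv' : (ω.I r)⁻¹ ≤ c⁻¹ := inv_anti₀ hc hu.1
    -- the position is not clipped
    have hb : b k ω = 1 / 8 * (ω.I r)⁻¹ + σ * (3 / 2) ^ n * D := by
      rw [← hbet]
      refine if_pos ?_
      rw [hbet]
      have h1 : |1 / 8 * (ω.I r)⁻¹ + σ * (3 / 2) ^ n * D| ≤ c⁻¹ := by
        refine (abs_add_le _ _).trans ?_
        rw [abs_mul, abs_of_pos hinv, abs_of_pos (show (0 : ℝ) < 1 / 8 by norm_num)]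
        linarith
      refine h1.trans ?_
      rw [inv_le_iff_one_le_mul₀ hc]
      have h2 : (2 : ℝ) ^ n * (16 * 2⁻¹ ^ n) ≤ 2 ^ n * c :=
        mul_le_mul_of_nonneg_left hn (by positivity)
      linarith
    set x := P.relIncr k t ω with hx
    have hxe : x = (ω.I r)⁻¹ * P.incr k t ω := (P.inv_mul_incr k t ω).symm
    have hx8 : |x| ≤ 1 / 8 := by
      rw [hxe, abs_mul, abs_of_pos hinv]
      calc (ω.I r)⁻¹ * |P.incr k t ω| ≤ c⁻¹ * (2 * 2⁻¹ ^ n) :=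
            mul_le_mul hinv' (hl.hasMesh k t ω) (abs_nonneg _) (inv_pos.2 hc).le
        _ ≤ c⁻¹ * (c / 8) := mul_le_mul_of_nonneg_left (by linarith) (inv_pos.2 hc).le
        _ = 1 / 8 := by field_simp
    have hzx : |σ * (3 / 2) ^ n * D * P.incr k t ω| ≤ |x| / 32 := by
      rw [hxe, abs_mul _ (P.incr k t ω), abs_mul _ (P.incr k t ω), abs_of_pos hinv,
        mul_div_right_comm]
      exact mul_le_mul_of_nonneg_right hz (abs_nonneg _)
    have hbx : b k ω * P.incr k t ω = x / 8 + σ * (3 / 2) ^ n * D * P.incr k t ω := by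
      rw [hb, hxe]; ring
    rw [hbx, ← mul_assoc]
    refine ⟨?_, log_one_add_eighth_add hx8 hzx⟩
    have h5 := (abs_le.1 hx8).1
    have h6 := (abs_le.1 hzx).1
    linarith
  rw [Partition.log_wealth fun k => (hterm k).1, growthApprox_eq_integral,
    growthApprox_eq_integral, ← hl.integral_eq, ← hr.integral_eq,
    ← P.sum_log_one_add_relIncr t ω, Partition.integral, Partition.integral,
    ← Finset.sum_sub_distrib, Finset.mul_sum, Finset.sum_div, ← Finset.sum_add_distrib]
  refine Finset.sum_le_sum fun k _ => le_trans (le_of_eq ?_) (hterm k).2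
  simp only [i, j]
  ring

theorem doubleGrid_hasMesh (n : ℕ) : (doubleGrid n).HasMesh (2 * (2 : ℝ)⁻¹ ^ n) :=
  (Partition.merge_refines_left (grid n) (grid (n + 1))).hasMesh

theorem clip_mul_mesh_le (n : ℕ) : (2 : ℝ) ^ n / 4 * (2 * 2⁻¹ ^ n) ≤ 1 / 2 := by
  have he2 : (2 : ℝ) ^ n * 2⁻¹ ^ n = 1 := by rw [← mul_pow]; norm_num
  linarith

theorem abs_clip_betweenGrids_le (σ : ℝ) (n k : ℕ) (ω : Path) :
    |Partition.clip (2 ^ n / 4) (betweenGrids σ n) k ω| ≤ 2 ^ n / 4 :=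
  Partition.abs_clip_le (by positivity) _ k ω

theorem exists_isGain_betweenGrids (σ : ℝ) (n : ℕ) : ∃ g, IsGain g ∧
    (∀ t ω, 0 ≤ 1 + g t ω) ∧ ∀ s t ω, s ≤ t → 2 * 2 ^ (n + 1) ≤ (doubleGrid n).wealth
      (Partition.clip (2 ^ n / 4) (betweenGrids σ n)) s ω → (2 : ℝ) ^ (n + 1) ≤ 1 + g t ω :=
  Partition.exists_isGain_of_wealth ((adapted_betweenGrids σ n).clip _) (doubleGrid_hasMesh n)
    (abs_clip_betweenGrids_le σ n) (clip_mul_mesh_le n) (2 ^ (n + 1))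

theorem exists_tendsto_of_abs_sub_succ_le {f : ℕ → ℝ} {A B : ℝ}
    (h : ∀ᶠ n : ℕ in atTop, |f n - f (n + 1)| ≤ (n * B + A) * (2 / 3) ^ n) :
    ∃ L, Tendsto f atTop (𝓝 L) := by
  have hr : ‖(2 / 3 : ℝ)‖ < 1 := by rw [Real.norm_eq_abs, abs_of_pos] <;> norm_num
  have hs : Summable fun n : ℕ => (n * B + A) * (2 / 3 : ℝ) ^ n := by
    have h1 := (summable_pow_mul_geometric_of_norm_lt_one 1 hr).mul_left B
    have h2 := (summable_geometric_of_norm_lt_one hr).mul_left A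
    refine (h1.add h2).congr fun n => ?_
    ring
  refine cauchySeq_tendsto_of_complete (cauchySeq_of_summable_dist ?_)
  refine Summable.of_norm_bounded_eventually_nat hs ?_
  filter_upwards [h] with n hn
  rwa [Real.norm_eq_abs, abs_of_nonneg dist_nonneg, Real.dist_eq]

/-- Two sequences of bets, one in each direction, on the differences of consecutive approximations
become infinitely rich in the mixture unless these differences are summable. -/
theorem exists_isTestSupermartingale_growth :
    ∃ Z : PriceProcess, IsTestSupermartingale Z ∧ (∀ ω, Z 0 ω = 1) ∧
      ∀ s t ω, s ≤ t → (¬ ∃ L, Tendsto (fun n => growthApprox n s ω) atTop (𝓝 L)) →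
        Z t ω = ⊤ := by
  choose g hg hpos hreach using exists_isGain_betweenGrids
  obtain ⟨Z, hZ, hZ0, hZtop⟩ := exists_isTestSupermartingale_eq_top
    (g := fun n t ω => 1 / 2 * (g 1 n t ω + g (-1) n t ω))
    (fun n => ((hg 1 n).add (hg (-1) n)).const_mul (1 / 2)) fun n t ω => by
      have h1 := hpos 1 n t ω
      have h2 := hpos (-1) n t ω
      linarith
  refine ⟨Z, hZ, hZ0, fun s t ω hst hnot => hZtop t ω ?_⟩
  by_contra hfreq
  rw [not_frequently] at hfreq
  obtain ⟨c, hc, hI⟩ := ω.exists_bounds s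
  have hlim1 : Tendsto (fun n : ℕ => 16 * (2 : ℝ)⁻¹ ^ n) atTop (𝓝 0) := by
    simpa using (tendsto_pow_atTop_nhds_zero_of_lt_one (r := (2 : ℝ)⁻¹) (by norm_num)
      (by norm_num)).const_mul 16
  have hlim2 : Tendsto (fun n : ℕ => 64 * ((3 / 2 : ℝ) ^ n * 2⁻¹ ^ n)) atTop (𝓝 0) := by
    simp only [← mul_pow]
    simpa using (tendsto_pow_atTop_nhds_zero_of_lt_one (r := (3 / 2 * 2⁻¹ : ℝ)) (by norm_num)
      (by norm_num)).const_mul 64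
  set A := 2 * Real.log 2 - Real.log (ω.I s) / 8 with hA
  refine hnot (exists_tendsto_of_abs_sub_succ_le (A := A) (B := Real.log 2) ?_)
  filter_upwards [hfreq, hlim1.eventually (ge_mem_nhds hc),
      hlim2.eventually (ge_mem_nhds (pow_pos hc 3))] with n hn h1 h2
  have hside : ∀ σ : ℝ, |σ| ≤ 1 → 1 + g σ n t ω < 2 ^ (n + 1) →
      σ * (growthApprox n s ω - growthApprox (n + 1) s ω) ≤
        (n * Real.log 2 + A) * (2 / 3) ^ n := by
    intro σ hσ hlt
    have hle := le_log_wealth_betweenGrids hσ hc hI h1 h2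
    have hw : (doubleGrid n).wealth (Partition.clip (2 ^ n / 4) (betweenGrids σ n)) s ω <
        2 * 2 ^ (n + 1) := by
      by_contra! h
      exact (hreach σ n s t ω hst h).not_gt hlt
    have hwpos : 0 < (doubleGrid n).wealth
        (Partition.clip (2 ^ n / 4) (betweenGrids σ n)) s ω :=
      Partition.prod_pos (doubleGrid_hasMesh n) (abs_clip_betweenGrids_le σ n)
        (clip_mul_mesh_le n) _ _ _
    have hlog := Real.log_le_log hwpos hw.le
    rw [← pow_succ', Real.log_pow] at hlog
    push_cast at hlog
    have h3 : (3 / 2 : ℝ) ^ n * (2 / 3) ^ n = 1 := by rw [← mul_pow]; norm_num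
    have h4 := mul_le_mul_of_nonneg_right (hle.trans hlog)
      (show (0 : ℝ) ≤ (2 / 3) ^ n by positivity)
    calc σ * (growthApprox n s ω - growthApprox (n + 1) s ω)
        = σ * (growthApprox n s ω - growthApprox (n + 1) s ω) *
            ((3 / 2 : ℝ) ^ n * (2 / 3) ^ n) := by rw [h3, mul_one]
      _ ≤ _ := by rw [hA]; linarith
  have hp := hpos 1 n t ω
  have hm := hpos (-1) n t ω
  rw [not_le] at hn
  have e1 := hside 1 (by simp) (by rw [pow_succ]; linarith)
  have e2 := hside (-1) (by simp) (by rw [pow_succ]; linarith)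
  rw [abs_le]
  constructor <;> linarith

/-! ### Variation and the limit of the leveraged strategies -/

section Limits

variable {t : ℝ≥0} {ω : Path} {c L V : ℝ}

theorem abs_relIncr_grid_le (hc : 0 < c) (hI : ∀ s ≤ t, c ≤ ω.I s ∧ ω.I s ≤ c⁻¹) (n k : ℕ) :
    |(grid n).relIncr k t ω| ≤ (2 : ℝ)⁻¹ ^ n / c := by
  have h := (hI _ (cap_le_right ((grid n).τ k ω) t)).1
  rw [Partition.relIncr, abs_div, abs_of_pos (hc.trans_le h)]
  exact div_le_div₀ (by positivity) (grid_hasMesh n k t ω) hc h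

theorem tendsto_mesh_div (c C : ℝ) :
    Tendsto (fun n : ℕ => C * ((2 : ℝ)⁻¹ ^ n / c)) atTop (𝓝 0) := by
  have h := ((tendsto_pow_atTop_nhds_zero_of_lt_one (r := (2 : ℝ)⁻¹) (by norm_num)
    (by norm_num)).div_const c).const_mul C
  simpa using h

/-- The logarithm of the capital of a strategy with constant leverage `a`, expanded to the second
order. For `a = 1` the capital is the value of the index. -/
theorem eventually_abs_sum_log_grid_sub_le (hc : 0 < c)
    (hI : ∀ s ≤ t, c ≤ ω.I s ∧ ω.I s ≤ c⁻¹) (a : ℝ) :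
    ∀ᶠ n in atTop, |∑ k ∈ Finset.range ((grid n).count t ω),
        Real.log (1 + a * (grid n).relIncr k t ω) -
          (a * growthApprox n t ω - a ^ 2 / 2 * variationApprox n t ω)| ≤
      2 * |a| ^ 3 * ((2 : ℝ)⁻¹ ^ n / c) * variationApprox n t ω := by
  filter_upwards [(tendsto_mesh_div c |a|).eventually
    (ge_mem_nhds (show (0 : ℝ) < 1 / 2 by norm_num))] with n hn
  rw [growthApprox_eq_sum, variationApprox_eq_sum]
  exact abs_sum_log_sub_le _ _ (fun k _ => abs_relIncr_grid_le hc hI n k) hn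

/-- Since `log I = M - Σ / 2` in the limit, the convergence of the cumulative growth implies that
of the variation. -/
theorem tendsto_variationApprox (hL : Tendsto (fun n => growthApprox n t ω) atTop (𝓝 L)) :
    Tendsto (fun n => variationApprox n t ω) atTop (𝓝 (2 * (L - Real.log (ω.I t)))) := by
  obtain ⟨c, hc, hI⟩ := ω.exists_bounds t
  have hexp : ∀ᶠ n in atTop, |Real.log (ω.I t) -
      (growthApprox n t ω - 1 / 2 * variationApprox n t ω)| ≤
        2 * ((2 : ℝ)⁻¹ ^ n / c) * variationApprox n t ω := by
    filter_upwards [eventually_abs_sum_log_grid_sub_le hc hI 1] with n hn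
    simpa [Partition.sum_log_one_add_relIncr] using hn
  have hnn : ∀ n, 0 ≤ variationApprox n t ω := fun n => by
    rw [variationApprox_eq_sum]
    exact Finset.sum_nonneg fun k _ => sq_nonneg _
  -- the variation is bounded, so the error of the expansion tends to zero
  have herr : ∀ᶠ n in atTop, |Real.log (ω.I t) -
      (growthApprox n t ω - 1 / 2 * variationApprox n t ω)| ≤
        8 * ((2 : ℝ)⁻¹ ^ n / c) * (growthApprox n t ω - Real.log (ω.I t)) := by
    filter_upwards [hexp, (tendsto_mesh_div c 8).eventually
      (ge_mem_nhds (show (0 : ℝ) < 1 by norm_num))] with n hn hsmall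
    have h1 : 8 * ((2 : ℝ)⁻¹ ^ n / c) * variationApprox n t ω ≤ 1 * variationApprox n t ω :=
      mul_le_mul_of_nonneg_right hsmall (hnn n)
    have h2 : variationApprox n t ω ≤ 4 * (growthApprox n t ω - Real.log (ω.I t)) := by
      have := (abs_le.1 hn).2
      linarith
    refine hn.trans ?_
    have h3 : 0 ≤ (2 : ℝ)⁻¹ ^ n / c := by positivity
    have h4 := mul_le_mul_of_nonneg_left h2 h3
    linarith
  have hzero : Tendsto (fun n => 8 * ((2 : ℝ)⁻¹ ^ n / c) *
      (growthApprox n t ω - Real.log (ω.I t))) atTop (𝓝 0) := by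
    simpa using (tendsto_mesh_div c 8).mul (hL.sub_const (Real.log (ω.I t)))
  have hdiff := squeeze_zero_norm' (herr.mono fun n hn => (Real.norm_eq_abs _).trans_le hn) hzero
  have h := ((hdiff.add hL).sub_const (Real.log (ω.I t))).const_mul 2
  rw [zero_add] at h
  refine h.congr fun n => ?_
  ring

/-- The relative positions of the strategy with constant leverage `a` on the grid of level `n`;
nothing is held where the leverage is too high for the capital to remain positive. -/
noncomputable def leveraged (a : ℝ) (n : ℕ) : ℕ → Path → ℝ :=
  Partition.clip (2 ^ n / 2) fun k ω => a * gridInv n k ω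

theorem adapted_leveraged (a : ℝ) (n : ℕ) : (grid n).Adapted (leveraged a n) :=
  ((grid n).adapted_inv_I.const_mul a).clip _

theorem abs_leveraged_le (a : ℝ) (n k : ℕ) (ω : Path) : |leveraged a n k ω| ≤ 2 ^ n / 2 :=
  Partition.abs_clip_le (by positivity) _ k ω

theorem leveraged_mul_mesh_le (n : ℕ) : (2 : ℝ) ^ n / 2 * 2⁻¹ ^ n ≤ 1 / 2 := by
  have he2 : (2 : ℝ) ^ n * 2⁻¹ ^ n = 1 := by rw [← mul_pow]; norm_num
  linarith

theorem wealth_leveraged_pos (a : ℝ) (n : ℕ) (t : ℝ≥0) (ω : Path) :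
    0 < (grid n).wealth (leveraged a n) t ω :=
  Partition.prod_pos (grid_hasMesh n) (abs_leveraged_le a n) (leveraged_mul_mesh_le n) _ _ _

theorem isGain_leveraged (a : ℝ) (n : ℕ) :
    IsGain fun t ω => (grid n).wealth (leveraged a n) t ω - 1 :=
  Partition.isGain_wealth (adapted_leveraged a n) (grid_hasMesh n) (abs_leveraged_le a n)
    (leveraged_mul_mesh_le n)

theorem tendsto_wealth_leveraged (a : ℝ)
    (hL : Tendsto (fun n => growthApprox n t ω) atTop (𝓝 L))
    (hV : Tendsto (fun n => variationApprox n t ω) atTop (𝓝 V)) :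
    Tendsto (fun n => (grid n).wealth (leveraged a n) t ω) atTop
      (𝓝 (Real.exp (a * L - a ^ 2 / 2 * V))) := by
  obtain ⟨c, hc, hI⟩ := ω.exists_bounds t
  have hlog : ∀ᶠ n in atTop, Real.log ((grid n).wealth (leveraged a n) t ω) =
      ∑ k ∈ Finset.range ((grid n).count t ω), Real.log (1 + a * (grid n).relIncr k t ω) := by
    filter_upwards [(tendsto_mesh_div c (2 * |a|)).eventually
      (ge_mem_nhds (show (0 : ℝ) < 1 by norm_num))] with n hn
    have hpos : ∀ k, 0 < 1 + leveraged a n k ω * (grid n).incr k t ω := fun k => by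
      have := (abs_le.1 (Partition.abs_mul_incr_le (grid_hasMesh n) (abs_leveraged_le a n)
        (leveraged_mul_mesh_le n) k t ω)).1
      linarith
    rw [Partition.log_wealth hpos]
    refine Finset.sum_congr rfl fun k _ => ?_
    congr 2
    rw [← (grid n).inv_mul_incr k t ω, ← mul_assoc]
    rcases le_total (gridTime n ω k) t with h | h
    · -- at large levels the positions are not clipped
      congr 1
      refine if_pos ?_
      have h1 : gridInv n k ω ≤ c⁻¹ := inv_anti₀ hc (hI _ (toNNReal_le_of_le_coe h)).1
      have h2 : 0 < gridInv n k ω := inv_pos.2 (ω.I_pos _)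
      rw [abs_mul, abs_of_pos h2]
      refine (mul_le_mul_of_nonneg_left h1 (abs_nonneg a)).trans ?_
      have he2 : (2 : ℝ) ^ n * 2⁻¹ ^ n = 1 := by rw [← mul_pow]; norm_num
      have h3 := mul_le_mul_of_nonneg_left hn (show (0 : ℝ) ≤ 2 ^ n / 2 by positivity)
      calc |a| * c⁻¹ = |a| * c⁻¹ * (2 ^ n * 2⁻¹ ^ n) := by rw [he2, mul_one]
        _ = 2 ^ n / 2 * (2 * |a| * (2⁻¹ ^ n / c)) := by rw [div_eq_mul_inv _ c]; ring
        _ ≤ 2 ^ n / 2 := by rwa [mul_one] at h3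
    · rw [(grid n).incr_eq_zero h, mul_zero, mul_zero]
  have hzero : Tendsto (fun n => 2 * |a| ^ 3 * ((2 : ℝ)⁻¹ ^ n / c) * variationApprox n t ω)
      atTop (𝓝 0) := by
    simpa using (tendsto_mesh_div c (2 * |a| ^ 3)).mul hV
  have hdiff := squeeze_zero_norm' ((eventually_abs_sum_log_grid_sub_le hc hI a).mono
    fun n hn => (Real.norm_eq_abs _).trans_le hn) hzero
  have h := hdiff.add ((hL.const_mul a).sub (hV.const_mul (a ^ 2 / 2)))
  rw [zero_add] at h
  refine ((Real.continuous_exp.tendsto _).comp h).congr' ?_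
  filter_upwards [hlog] with n hn
  rw [Function.comp_apply, sub_add_cancel, ← hn, Real.exp_log (wealth_leveraged_pos a n t ω)]

end Limits

end EfficientIndex

theorem mainTheorem5 (ε : ℝ) :
    ∃ Y : EfficientIndex.PriceProcess, EfficientIndex.IsTestISupermartingale Y ∧
      EfficientIndex.QuasiAlways {p : ℝ≥0 × EfficientIndex.Path |
        Tendsto (fun n => EfficientIndex.growthApprox n p.1 p.2) atTop
          (𝓝 (EfficientIndex.growth p.1 p.2)) ∧
        Tendsto (fun n => EfficientIndex.variationApprox n p.1 p.2) atTop
          (𝓝 (EfficientIndex.variation p.1 p.2)) ∧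
        Y p.1 p.2 =
          ((Real.exp
            (ε * (EfficientIndex.growth p.1 p.2 - EfficientIndex.variation p.1 p.2) -
              ε ^ 2 / 2 * EfficientIndex.variation p.1 p.2) : ℝ) : EReal)} := by
  obtain ⟨Z, hZ, hZ0, hZtop⟩ := EfficientIndex.exists_isTestSupermartingale_growth
  refine ⟨_, ⟨_, .liminf _ fun n =>
    (EfficientIndex.isGain_leveraged (1 + ε) n).isTestSupermartingale (c := 1) fun t ω => ?_, rfl⟩,
    Z, hZ, hZ0, fun t ω ⟨s, hst, hs⟩ => hZtop s t ω hst.le fun ⟨L, hL⟩ =>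
      hs ?_⟩
  · rw [add_sub_cancel]; exact (EfficientIndex.wealth_leveraged_pos _ n t ω).le
  · have hV := EfficientIndex.tendsto_variationApprox hL
    have hgrowth : EfficientIndex.growth s ω = L := hL.limUnder_eq
    have hvar : EfficientIndex.variation s ω = 2 * (L - Real.log (ω.I s)) := hV.limUnder_eq
    refine ⟨by rw [hgrowth]; exact hL, by rw [hvar]; exact hV, ?_⟩
    have hX := ((continuous_coe_real_ereal.tendsto _).comp
      (EfficientIndex.tendsto_wealth_leveraged (1 + ε) hL hV)).liminf_eq
    simp only [Function.comp_def] at hX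
    simp only [add_sub_cancel, hX, hgrowth, hvar]
    rw [← EReal.coe_div]
    congr 1
    have he := Real.exp_log (ω.I_pos s)
    generalize Real.log (ω.I s) = l at he ⊢
    rw [← he, ← Real.exp_sub]
    congr 1
    ring
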